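/- Let $\mathbb{Q}(A)$ be the field of rational functions in $A$. All skein modules are Kauffman bracket skein modules over $\mathbb{Q}(A)$: the free module on isotopy classes of framed links (or framed tangles with fixed marked boundary points) modulo the relations (crossing) $=A\,(A\text{-smoothing})+A^{-1}(A^{-1}\text{-smoothing})$ and $L\sqcup\bigcirc=-(A^2+A^{-2})L$. Let $TL_m$ be the skein module of the disc with $m$ marked points on the bottom and $m$ on the top, and let $\mathcal{S}(S^1\times I)$ be the skein module of the annulus. Let $STC_m:TL_m\to\mathcal{S}(S^1\times I)$ be the solid torus closure, which joins the $m$ top points to the $m$ bottom points by parallel arcs going around the annulus. Let $f^{(m)}\in TL_m$ be the Jones--Wenzl projector, and let $z^k\in\mathcal{S}(S^1\times I)$ be the class of $k$ parallel copies of the core of the annulus. For $n\ge 0$ let $TL_4^n\subseteq TL_{2n}$ be the colored Temperley--Lieb module, i.e. the submodule of all elements $(f^{(n)}\otimes f^{(n)})\,x\,(f^{(n)}\otimes f^{(n)})$ with $x\in TL_{2n}$, and let $STC'_{2n}$ be the restriction of $STC_{2n}$ to $TL_4^n$. For $0\le i\le n$ let $B_{n,i}\in TL^n_4$ be the element given by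 two trivalent vertices of type $(n,n,2i)$ joined along their edges colored $2i$, the edges colored $n$ of one vertex ending at the top marked points and those of the other at the bottom marked points. Let $\theta(n,n,2i)$ be the Kauffman bracket of the planar theta graph with edges colored $n,n,2i$, let $\Delta_m=(-1)^m\frac{A^{2(m+1)}-A^{-2(m+1)}}{A^2-A^{-2}}$, and let $S_j=S_j(z)$ be the Chebyshev elements given by $S_0=1$, $S_1=z$, $S_{j+2}=zS_{j+1}-S_j$. **Theorem.** For every $n\ge 0$: 1. $STC'_{2n}:TL_4^n\to\mathcal{S}(S^1\times I)$ is an isomorphism of $\mathbb{Q}(A)$-modules onto its image (equivalently, it is injective). 2. The elements $B_{n,0},\dots,B_{n,n}$ form a basis of $TL_4^n$, and $STC'_{2n}(B_{n,i})=\dfrac{\theta(n,n,2i)}{\Delta_{2i}}\,S_{2i}$ for $0\le i\le n$. 3. The elements $S_0,S_1,S_2,\dots$ form a basis of $\mathcal{S}(S^1\times I)$. -/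

import Mathlib

namespace KauffmanSkein

/-! ### Diagrams of framed tangles in the disc

A diagram in the disc (drawn as a rectangle, with `m` marked points on the bottom edge and `n` on the
top edge) is put in general position with respect to the height function and cut into horizontal
slices, each of which contains exactly one local maximum, local minimum or crossing. Framings are
blackboard framings. -/

/-- The four elementary pieces: a local minimum `cup`, a local maximum `cap`, and the two crossings.
In `overX` the strand from the lower left to the upper right is on top, in `underX` the other one. -/
inductive Kind : Type
  | cup
  | cap
  | overX
  | underX

/-- Number of strands entering an elementary piece from below. -/
def Kind.ins : Kind → ℕ
  | .cup => 0
  | .cap => 2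
  | .overX => 2
  | .underX => 2

/-- Number of strands leaving an elementary piece at its top. -/
def Kind.outs : Kind → ℕ
  | .cup => 2
  | .cap => 0
  | .overX => 2
  | .underX => 2

/-- A slice: an elementary piece with `pos` vertical strands to its left
(the strands to its right are determined by the total number of strands). -/
structure Slice : Type where
  kind : Kind
  pos : ℕ

/-- The slice with `k` more vertical strands on the left. -/
def Slice.shift (k : ℕ) (s : Slice) : Slice := ⟨s.kind, k + s.pos⟩

def cup (i : ℕ) : Slice := ⟨.cup, i⟩
def cap (i : ℕ) : Slice := ⟨.cap, i⟩
def overX (i : ℕ) : Slice := ⟨.overX, i⟩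
def underX (i : ℕ) : Slice := ⟨.underX, i⟩

/-- `IsDiagram m w n`: the slices of `w`, stacked from bottom (head of the list) to top, form a
diagram with `m` end points at the bottom and `n` end points at the top. -/
def IsDiagram : ℕ → List Slice → ℕ → Prop
  | m, [], n => m = n
  | m, s :: w, n => s.pos + s.kind.ins ≤ m ∧ IsDiagram (m - s.kind.ins + s.kind.outs) w n

theorem IsDiagram.append {u v : List Slice} {a n : ℕ} :
    ∀ {m : ℕ}, IsDiagram m u a → IsDiagram a v n → IsDiagram m (u ++ v) n := by
  induction u with
  | nil => intro m hu hv; cases hu; exact hv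
  | cons s u ih => intro m hu hv; exact ⟨hu.1, ih hu.2 hv⟩

theorem IsDiagram.addRight (r : ℕ) {w : List Slice} {n : ℕ} :
    ∀ {m : ℕ}, IsDiagram m w n → IsDiagram (m + r) w (n + r) := by
  induction w with
  | nil => intro m h; cases h; rfl
  | cons s w ih =>
    intro m h
    have h1 := h.1
    refine ⟨by omega, ?_⟩
    have e : m + r - s.kind.ins + s.kind.outs = m - s.kind.ins + s.kind.outs + r := by omega
    rw [e]
    exact ih h.2

theorem IsDiagram.addLeft (k : ℕ) {w : List Slice} {n : ℕ} :
    ∀ {m : ℕ}, IsDiagram m w n → IsDiagram (k + m) (w.map (Slice.shift k)) (k + n) := by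
  induction w with
  | nil => intro m h; cases h; rfl
  | cons s w ih =>
    intro m h
    have h1 := h.1
    refine ⟨by simp only [Slice.shift]; omega, ?_⟩
    have e : k + m - s.kind.ins + s.kind.outs = k + (m - s.kind.ins + s.kind.outs) := by omega
    simp only [Slice.shift]
    rw [e]
    exact ih h.2

/-- Diagrams in the disc with `m` marked points at the bottom and `n` at the top. -/
def Diagram (m n : ℕ) : Type := {w : List Slice // IsDiagram m w n}

/-- `n` parallel vertical strands. -/
def Diagram.id (n : ℕ) : Diagram n n := ⟨[], rfl⟩

/-- Vertical stacking: `E` on top of `D`. -/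
def Diagram.comp {m n k : ℕ} (D : Diagram m n) (E : Diagram n k) : Diagram m k :=
  ⟨D.1 ++ E.1, D.2.append E.2⟩

/-- Horizontal juxtaposition: `E` to the right of `D`. -/
def Diagram.tensor {m n m' n' : ℕ} (D : Diagram m n) (E : Diagram m' n') :
    Diagram (m + m') (n + n') :=
  ⟨D.1 ++ E.1.map (Slice.shift n), (D.2.addRight m').append (E.2.addLeft n)⟩

/-! ### Isotopy of framed tangles and of framed links in the solid torus -/

/-- The local moves on sliced diagrams that generate isotopy of framed unoriented tangles. -/
inductive Move : List Slice → List Slice → Prop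
  /-- Two pieces lying side by side may exchange their heights. -/
  | exchange (x y : Kind) (i d : ℕ) :
      Move [⟨x, i⟩, ⟨y, i + x.outs + d⟩] [⟨y, i + x.ins + d⟩, ⟨x, i⟩]
  /-- Cancellation of a maximum with a minimum. -/
  | snake_left (i : ℕ) : Move [cup i, cap (i + 1)] []
  | snake_right (i : ℕ) : Move [cup (i + 1), cap i] []
  /-- A crossing slides over a minimum or a maximum. -/
  | cup_over (i : ℕ) : Move [cup i, overX (i + 1)] [cup (i + 1), underX i]
  | cup_under (i : ℕ) : Move [cup i, underX (i + 1)] [cup (i + 1), overX i]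
  | over_cap (i : ℕ) : Move [overX (i + 1), cap i] [underX i, cap (i + 1)]
  | under_cap (i : ℕ) : Move [underX (i + 1), cap i] [overX i, cap (i + 1)]
  /-- Framed first Reidemeister move: curls of equal framing to the right and left agree. -/
  | curl (i : ℕ) : Move [cup (i + 1), overX i, cap (i + 1)] [cup i, overX (i + 1), cap i]
  /-- Second Reidemeister move. -/
  | over_under (i : ℕ) : Move [overX i, underX i] []
  | under_over (i : ℕ) : Move [underX i, overX i] []
  /-- Third Reidemeister move. -/
  | braid (i : ℕ) : Move [overX i, overX (i + 1), overX i] [overX (i + 1), overX i, overX (i + 1)]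

/-- Two diagrams that differ by one local move. -/
def Step {m n : ℕ} (D D' : Diagram m n) : Prop :=
  ∃ u v l r : List Slice, Move l r ∧ D.1 = u ++ l ++ v ∧ D'.1 = u ++ r ++ v

/-- Isotopy classes (rel boundary) of framed tangles in (disc) × I: diagrams modulo the equivalence
relation generated by the moves. -/
abbrev FramedTangle (m n : ℕ) : Type := Quot (@Step m n)

/-- A diagram in the annulus: cut open along a ray that it meets in `k` points, it becomes a diagram
in the rectangle with `k` points at the bottom and `k` at the top. `⟨k, D⟩` is the closure of `D`, its
`k` top points being joined around the annulus to its `k` bottom points by parallel arcs. -/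
abbrev AnnularDiagram : Type := Σ k : ℕ, Diagram k k

/-- Elementary isotopies of annular diagrams: a local move away from the ray, or rotation of the ray
along which the annulus is cut open. -/
inductive AnnularStep : AnnularDiagram → AnnularDiagram → Prop
  | move {k : ℕ} {D D' : Diagram k k} : Step D D' → AnnularStep ⟨k, D⟩ ⟨k, D'⟩
  | rotate {m n : ℕ} (D : Diagram m n) (E : Diagram n m) :
      AnnularStep ⟨m, D.comp E⟩ ⟨n, E.comp D⟩

/-- Isotopy classes of framed links in the solid torus (annulus) × I. -/
abbrev AnnularLink : Type := Quot AnnularStep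

/-! ### Kauffman bracket skein modules over `ℚ(A)` -/

/-- The field `ℚ(A)`. -/
abbrev QA : Type := RatFunc ℚ

noncomputable section

/-- The indeterminate `A`. -/
def A : QA := RatFunc.X

/-- The value `-A² - A⁻²` of a trivial circle. -/
def δ : QA := -A ^ 2 - A⁻¹ ^ 2

/-- `D`, `D₀`, `D₁` agree except in a ball, where `D` is a crossing, `D₀` its `A`-smoothing and `D₁` its
`A⁻¹`-smoothing. -/
def KauffmanTriple {m n : ℕ} (D D₀ D₁ : Diagram m n) : Prop :=
  ∃ (u v : List Slice) (i : ℕ), D.1 = u ++ [overX i] ++ v ∧ D₀.1 = u ++ v ∧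
    D₁.1 = u ++ [cap i, cup i] ++ v

/-- `D` is `D₀` together with a disjoint circle that bounds a disc. -/
def AddsCircle {m n : ℕ} (D D₀ : Diagram m n) : Prop :=
  ∃ (u v : List Slice) (i : ℕ), D.1 = u ++ [cup i, cap i] ++ v ∧ D₀.1 = u ++ v

/-- The framed tangle of a diagram, as a generator of the free module. -/
def tangle {m n : ℕ} (D : Diagram m n) : FramedTangle m n →₀ QA := Finsupp.single (Quot.mk _ D) 1

/-- The framed link of an annular diagram, as a generator of the free module. -/
def link {k : ℕ} (D : Diagram k k) : AnnularLink →₀ QA :=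
  Finsupp.single (Quot.mk _ ⟨k, D⟩) 1

/-- The Kauffman bracket relations for tangles in the disc. -/
def relations (m n : ℕ) : Submodule QA (FramedTangle m n →₀ QA) :=
  Submodule.span QA
    ({x | ∃ D D₀ D₁ : Diagram m n, KauffmanTriple D D₀ D₁ ∧
        x = tangle D - A • tangle D₀ - A⁻¹ • tangle D₁} ∪
     {x | ∃ D D₀ : Diagram m n, AddsCircle D D₀ ∧
        x = tangle D + (A ^ 2 + A⁻¹ ^ 2) • tangle D₀})

/-- The Kauffman bracket relations for links in the solid torus. -/
def annularRelations : Submodule QA (AnnularLink →₀ QA) :=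
  Submodule.span QA
    ({x | ∃ (k : ℕ) (D D₀ D₁ : Diagram k k), KauffmanTriple D D₀ D₁ ∧
        x = link D - A • link D₀ - A⁻¹ • link D₁} ∪
     {x | ∃ (k : ℕ) (D D₀ : Diagram k k), AddsCircle D D₀ ∧
        x = link D + (A ^ 2 + A⁻¹ ^ 2) • link D₀})

/-- The relative Kauffman bracket skein module of the disc with `m` marked points at the bottom and
`n` at the top. -/
abbrev Skein (m n : ℕ) : Type := (FramedTangle m n →₀ QA) ⧸ relations m n

/-- The Temperley-Lieb algebra `TL_n`, with product `comp` below. -/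
abbrev TL (n : ℕ) : Type := Skein n n

/-- The Kauffman bracket skein module `𝒮(S¹ × I)` of the annulus. -/
abbrev AnnularSkein : Type := (AnnularLink →₀ QA) ⧸ annularRelations

/-- The class of a diagram. -/
def mk {m n : ℕ} (D : Diagram m n) : Skein m n := (relations m n).mkQ (tangle D)

/-- The class in `𝒮(S¹ × I)` of the closure of a diagram. -/
def mkClosure {k : ℕ} (D : Diagram k k) : AnnularSkein := annularRelations.mkQ (link D)

theorem mk_step {m n : ℕ} {D D' : Diagram m n} (h : Step D D') : mk D = mk D' := by
  unfold mk tangle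
  rw [Quot.sound h]

theorem mkClosure_step {k : ℕ} {D D' : Diagram k k} (h : Step D D') :
    mkClosure D = mkClosure D' := by
  unfold mkClosure link
  rw [Quot.sound (AnnularStep.move h)]

theorem mk_triple {m n : ℕ} {D D₀ D₁ : Diagram m n} (h : KauffmanTriple D D₀ D₁) :
    mk D = A • mk D₀ + A⁻¹ • mk D₁ := by
  have := (Submodule.Quotient.mk_eq_zero (relations m n)).2
    (Submodule.subset_span (Or.inl ⟨D, D₀, D₁, h, rfl⟩))
  simp only [Submodule.Quotient.mk_sub, Submodule.Quotient.mk_smul] at this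
  simp only [mk, Submodule.mkQ_apply]
  rw [sub_sub, sub_eq_zero] at this
  exact this

theorem mk_circle {m n : ℕ} {D D₀ : Diagram m n} (h : AddsCircle D D₀) : mk D = δ • mk D₀ := by
  have := (Submodule.Quotient.mk_eq_zero (relations m n)).2
    (Submodule.subset_span (Or.inr ⟨D, D₀, h, rfl⟩))
  simp only [Submodule.Quotient.mk_add, Submodule.Quotient.mk_smul] at this
  simp only [mk, Submodule.mkQ_apply]
  rw [add_eq_zero_iff_eq_neg, ← neg_smul] at this
  rw [this, δ]
  congr 1
  ring

theorem mkClosure_triple {k : ℕ} {D D₀ D₁ : Diagram k k} (h : KauffmanTriple D D₀ D₁) :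
    mkClosure D = A • mkClosure D₀ + A⁻¹ • mkClosure D₁ := by
  have := (Submodule.Quotient.mk_eq_zero annularRelations).2
    (Submodule.subset_span (Or.inl ⟨k, D, D₀, D₁, h, rfl⟩))
  simp only [Submodule.Quotient.mk_sub, Submodule.Quotient.mk_smul] at this
  simp only [mkClosure, Submodule.mkQ_apply]
  rw [sub_sub, sub_eq_zero] at this
  exact this

theorem mkClosure_circle {k : ℕ} {D D₀ : Diagram k k} (h : AddsCircle D D₀) :
    mkClosure D = δ • mkClosure D₀ := by
  have := (Submodule.Quotient.mk_eq_zero annularRelations).2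
    (Submodule.subset_span (Or.inr ⟨k, D, D₀, h, rfl⟩))
  simp only [Submodule.Quotient.mk_add, Submodule.Quotient.mk_smul] at this
  simp only [mkClosure, Submodule.mkQ_apply]
  rw [add_eq_zero_iff_eq_neg, ← neg_smul] at this
  rw [this, δ]
  congr 1
  ring

/-- A function on diagrams that respects isotopy and the Kauffman bracket relations induces a linear
map on the skein module. -/
def lift {m n : ℕ} {M : Type} [AddCommGroup M] [Module QA M] (F : Diagram m n → M)
    (hs : ∀ D D', Step D D' → F D = F D')
    (ht : ∀ D D₀ D₁, KauffmanTriple D D₀ D₁ → F D = A • F D₀ + A⁻¹ • F D₁)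
    (hc : ∀ D D₀, AddsCircle D D₀ → F D = δ • F D₀) : Skein m n →ₗ[QA] M :=
  (relations m n).liftQ (Finsupp.linearCombination QA (Quot.lift F hs)) (by
    refine Submodule.span_le.2 ?_
    rintro x (⟨D, D₀, D₁, h, rfl⟩ | ⟨D, D₀, h, rfl⟩)
    · have := ht _ _ _ h
      simp only [SetLike.mem_coe, LinearMap.mem_ker, map_sub, map_smul, tangle,
        Finsupp.linearCombination_single, one_smul, this]
      abel
    · have := hc _ _ h
      simp only [SetLike.mem_coe, LinearMap.mem_ker, map_add, map_smul, tangle,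
        Finsupp.linearCombination_single, one_smul, this, ← add_smul, δ]
      convert zero_smul QA (F D₀) using 2
      ring)

@[simp] theorem lift_mk {m n : ℕ} {M : Type} [AddCommGroup M] [Module QA M] (F : Diagram m n → M)
    (hs : ∀ D D', Step D D' → F D = F D')
    (ht : ∀ D D₀ D₁, KauffmanTriple D D₀ D₁ → F D = A • F D₀ + A⁻¹ • F D₁)
    (hc : ∀ D D₀, AddsCircle D D₀ → F D = δ • F D₀) (D : Diagram m n) :
    lift F hs ht hc (mk D) = F D := by
  refine (Submodule.liftQ_apply _ _ _).trans ?_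
  simp [tangle]

theorem hom_ext {m n : ℕ} {M : Type} [AddCommGroup M] [Module QA M] {f g : Skein m n →ₗ[QA] M}
    (h : ∀ D, f (mk D) = g (mk D)) : f = g := by
  refine Submodule.linearMap_qext _ (Finsupp.lhom_ext' fun t => LinearMap.ext_ring ?_)
  induction t using Quot.ind with
  | mk D => exact h D

theorem Move.map_shift (k : ℕ) {l r : List Slice} (h : Move l r) :
    Move (l.map (Slice.shift k)) (r.map (Slice.shift k)) := by
  cases h with
  | exchange x y i d =>
    have := Move.exchange x y (k + i) d
    simpa [Slice.shift, add_assoc] using this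
  | snake_left i => exact Move.snake_left (k + i)
  | snake_right i => exact Move.snake_right (k + i)
  | cup_over i => exact Move.cup_over (k + i)
  | cup_under i => exact Move.cup_under (k + i)
  | over_cap i => exact Move.over_cap (k + i)
  | under_cap i => exact Move.under_cap (k + i)
  | curl i => exact Move.curl (k + i)
  | over_under i => exact Move.over_under (k + i)
  | under_over i => exact Move.under_over (k + i)
  | braid i => exact Move.braid (k + i)

section
variable {m n m' n' k : ℕ}

theorem Step.comp_right {D D' : Diagram m n} (h : Step D D') (E : Diagram n k) :
    Step (D.comp E) (D'.comp E) := by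
  obtain ⟨u, v, l, r, hm, h1, h2⟩ := h
  exact ⟨u, v ++ E.1, l, r, hm, by simp [Diagram.comp, h1], by simp [Diagram.comp, h2]⟩

theorem Step.comp_left (D : Diagram m n) {E E' : Diagram n k} (h : Step E E') :
    Step (D.comp E) (D.comp E') := by
  obtain ⟨u, v, l, r, hm, h1, h2⟩ := h
  exact ⟨D.1 ++ u, v, l, r, hm, by simp [Diagram.comp, h1], by simp [Diagram.comp, h2]⟩

theorem Step.tensor_right {D D' : Diagram m n} (h : Step D D') (E : Diagram m' n') :
    Step (D.tensor E) (D'.tensor E) := by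
  obtain ⟨u, v, l, r, hm, h1, h2⟩ := h
  exact ⟨u, v ++ E.1.map (Slice.shift n), l, r, hm, by simp [Diagram.tensor, h1],
    by simp [Diagram.tensor, h2]⟩

theorem Step.tensor_left (D : Diagram m n) {E E' : Diagram m' n'} (h : Step E E') :
    Step (D.tensor E) (D.tensor E') := by
  obtain ⟨u, v, l, r, hm, h1, h2⟩ := h
  exact ⟨D.1 ++ u.map (Slice.shift n), v.map (Slice.shift n), _, _, hm.map_shift n,
    by simp [Diagram.tensor, h1], by simp [Diagram.tensor, h2]⟩

theorem KauffmanTriple.comp_right {D D₀ D₁ : Diagram m n} (h : KauffmanTriple D D₀ D₁)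
    (E : Diagram n k) : KauffmanTriple (D.comp E) (D₀.comp E) (D₁.comp E) := by
  obtain ⟨u, v, i, h1, h2, h3⟩ := h
  exact ⟨u, v ++ E.1, i, by simp [Diagram.comp, h1], by simp [Diagram.comp, h2],
    by simp [Diagram.comp, h3]⟩

theorem KauffmanTriple.comp_left (D : Diagram m n) {E E₀ E₁ : Diagram n k}
    (h : KauffmanTriple E E₀ E₁) : KauffmanTriple (D.comp E) (D.comp E₀) (D.comp E₁) := by
  obtain ⟨u, v, i, h1, h2, h3⟩ := h
  exact ⟨D.1 ++ u, v, i, by simp [Diagram.comp, h1], by simp [Diagram.comp, h2],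
    by simp [Diagram.comp, h3]⟩

theorem KauffmanTriple.tensor_right {D D₀ D₁ : Diagram m n} (h : KauffmanTriple D D₀ D₁)
    (E : Diagram m' n') : KauffmanTriple (D.tensor E) (D₀.tensor E) (D₁.tensor E) := by
  obtain ⟨u, v, i, h1, h2, h3⟩ := h
  exact ⟨u, v ++ E.1.map (Slice.shift n), i, by simp [Diagram.tensor, h1],
    by simp [Diagram.tensor, h2], by simp [Diagram.tensor, h3]⟩

theorem KauffmanTriple.tensor_left (D : Diagram m n) {E E₀ E₁ : Diagram m' n'}
    (h : KauffmanTriple E E₀ E₁) :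
    KauffmanTriple (D.tensor E) (D.tensor E₀) (D.tensor E₁) := by
  obtain ⟨u, v, i, h1, h2, h3⟩ := h
  exact ⟨D.1 ++ u.map (Slice.shift n), v.map (Slice.shift n), n + i,
    by simp [Diagram.tensor, h1, Slice.shift, overX],
    by simp [Diagram.tensor, h2], by simp [Diagram.tensor, h3, Slice.shift, cup, cap]⟩

theorem AddsCircle.comp_right {D D₀ : Diagram m n} (h : AddsCircle D D₀) (E : Diagram n k) :
    AddsCircle (D.comp E) (D₀.comp E) := by
  obtain ⟨u, v, i, h1, h2⟩ := h
  exact ⟨u, v ++ E.1, i, by simp [Diagram.comp, h1], by simp [Diagram.comp, h2]⟩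

theorem AddsCircle.comp_left (D : Diagram m n) {E E₀ : Diagram n k} (h : AddsCircle E E₀) :
    AddsCircle (D.comp E) (D.comp E₀) := by
  obtain ⟨u, v, i, h1, h2⟩ := h
  exact ⟨D.1 ++ u, v, i, by simp [Diagram.comp, h1], by simp [Diagram.comp, h2]⟩

theorem AddsCircle.tensor_right {D D₀ : Diagram m n} (h : AddsCircle D D₀) (E : Diagram m' n') :
    AddsCircle (D.tensor E) (D₀.tensor E) := by
  obtain ⟨u, v, i, h1, h2⟩ := h
  exact ⟨u, v ++ E.1.map (Slice.shift n), i, by simp [Diagram.tensor, h1],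
    by simp [Diagram.tensor, h2]⟩

theorem AddsCircle.tensor_left (D : Diagram m n) {E E₀ : Diagram m' n'} (h : AddsCircle E E₀) :
    AddsCircle (D.tensor E) (D.tensor E₀) := by
  obtain ⟨u, v, i, h1, h2⟩ := h
  exact ⟨D.1 ++ u.map (Slice.shift n), v.map (Slice.shift n), n + i,
    by simp [Diagram.tensor, h1, Slice.shift, cup, cap], by simp [Diagram.tensor, h2]⟩

/-- Vertical stacking, extended bilinearly to skein modules (first argument at the bottom). -/
def comp : Skein m n →ₗ[QA] Skein n k →ₗ[QA] Skein m k :=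
  lift (fun D => lift (fun E => mk (D.comp E))
      (fun _ _ h => mk_step (h.comp_left D))
      (fun _ _ _ h => mk_triple (h.comp_left D))
      (fun _ _ h => mk_circle (h.comp_left D)))
    (fun _ _ h => hom_ext fun E => by simpa using mk_step (h.comp_right E))
    (fun _ _ _ h => hom_ext fun E => by simpa using mk_triple (h.comp_right E))
    (fun _ _ h => hom_ext fun E => by simpa using mk_circle (h.comp_right E))

/-- Horizontal juxtaposition, extended bilinearly to skein modules. -/
def tensor : Skein m n →ₗ[QA] Skein m' n' →ₗ[QA] Skein (m + m') (n + n') :=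
  lift (fun D => lift (fun E => mk (D.tensor E))
      (fun _ _ h => mk_step (h.tensor_left D))
      (fun _ _ _ h => mk_triple (h.tensor_left D))
      (fun _ _ h => mk_circle (h.tensor_left D)))
    (fun _ _ h => hom_ext fun E => by simpa using mk_step (h.tensor_right E))
    (fun _ _ _ h => hom_ext fun E => by simpa using mk_triple (h.tensor_right E))
    (fun _ _ h => hom_ext fun E => by simpa using mk_circle (h.tensor_right E))

end

/-- The solid torus closure `STC_k : TL_k → 𝒮(S¹ × I)`. -/
def STC (k : ℕ) : TL k →ₗ[QA] AnnularSkein :=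
  lift (fun D => mkClosure D) (fun _ _ h => mkClosure_step h)
    (fun _ _ _ h => mkClosure_triple h) (fun _ _ h => mkClosure_circle h)

/-! ### Jones-Wenzl projectors and the colored Temperley-Lieb module -/

/-- `Δ_n = (-1)ⁿ [n + 1]`, where `[k] = (A^{2k} - A^{-2k}) / (A² - A⁻²)`. -/
def Δ (n : ℕ) : QA :=
  (-1) ^ n * (A ^ (2 * (n + 1)) - A⁻¹ ^ (2 * (n + 1))) / (A ^ 2 - A⁻¹ ^ 2)

/-- The hook on the last two of `n + 2` strands. -/
def hook (n : ℕ) : Diagram (n + 2) (n + 2) :=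
  ⟨[cap n, cup n], by simp [IsDiagram, cap, cup, Kind.ins, Kind.outs]⟩

/-- The Jones-Wenzl projector `f^{(n)} ∈ TL_n`, by Wenzl's recursion. -/
def jonesWenzl : (n : ℕ) → TL n
  | 0 => mk (Diagram.id 0)
  | 1 => mk (Diagram.id 1)
  | n + 2 =>
    let g : TL (n + 2) := tensor (jonesWenzl (n + 1)) (mk (Diagram.id 1))
    g - (Δ n / Δ (n + 1)) • comp (comp g (mk (hook n))) g

/-- Two boxes `f^{(n)}` side by side. -/
def twoBoxes (n : ℕ) : TL (n + n) := tensor (jonesWenzl n) (jonesWenzl n)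

/-- The colored Temperley-Lieb module: the elements of `TL_{2n}` of the form
`(f^{(n)} ⊗ f^{(n)}) x (f^{(n)} ⊗ f^{(n)})`. -/
def coloredTL (n : ℕ) : Submodule QA (TL (n + n)) :=
  LinearMap.range ((comp (twoBoxes n)).comp (comp.flip (twoBoxes n)))

/-- The restriction `STC'_{2n}` of `STC_{2n}` to the colored Temperley-Lieb module. -/
def STC' (n : ℕ) : coloredTL n →ₗ[QA] AnnularSkein := (STC (n + n)).domRestrict (coloredTL n)

theorem isDiagram_cups (k : ℕ) : ∀ i : ℕ,
    IsDiagram (i + i) ((List.range' i k).map cup) (i + k + (i + k)) := by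
  induction k with
  | zero => intro i; rfl
  | succ k ih =>
    intro i
    rw [List.range'_succ]
    refine ⟨by simp [cup, Kind.ins], ?_⟩
    have e : i + i - (cup i).kind.ins + (cup i).kind.outs = i + 1 + (i + 1) := by
      simp only [cup, Kind.ins, Kind.outs]; omega
    have e' : i + (k + 1) + (i + (k + 1)) = i + 1 + k + (i + 1 + k) := by omega
    rw [e, e']
    exact ih (i + 1)

theorem isDiagram_caps (k : ℕ) : ∀ i : ℕ,
    IsDiagram (i + k + (i + k)) ((List.range' i k).map cap).reverse (i + i) := by
  induction k with
  | zero => intro i; rfl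
  | succ k ih =>
    intro i
    rw [List.range'_succ, List.map_cons, List.reverse_cons]
    have e' : i + (k + 1) + (i + (k + 1)) = i + 1 + k + (i + 1 + k) := by omega
    rw [e']
    refine (ih (i + 1)).append ⟨?_, ?_⟩
    · simp only [cap, Kind.ins]; omega
    · simp only [cap, Kind.ins, Kind.outs, IsDiagram]; omega

/-- `i` vertical strands, then `n - i` nested cups, then `i` vertical strands. -/
def cups (i n : ℕ) (h : i ≤ n) : Diagram (i + i) (n + n) :=
  ⟨(List.range' i (n - i)).map cup, by
    have := isDiagram_cups (n - i) i
    rwa [Nat.add_sub_cancel' h] at this⟩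

/-- `i` vertical strands, then `n - i` nested caps, then `i` vertical strands. -/
def caps (i n : ℕ) (h : i ≤ n) : Diagram (n + n) (i + i) :=
  ⟨((List.range' i (n - i)).map cap).reverse, by
    have := isDiagram_caps (n - i) i
    rwa [Nat.add_sub_cancel' h] at this⟩

/-- The element `B_{n,i}`: two trivalent vertices `(n, n, 2i)` joined along their edges colored `2i`,
with the edges colored `n` of one vertex ending at the bottom and those of the other at the top. -/
def B (n i : ℕ) (h : i ≤ n) : TL (n + n) :=
  comp (twoBoxes n) (comp (mk (caps i n h)) (comp (jonesWenzl (i + i))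
    (comp (mk (cups i n h)) (twoBoxes n))))

/-- The closure of an element of `TL_m` in the plane. -/
def planeClosure {m : ℕ} (x : TL m) : TL 0 :=
  comp (comp (mk (cups 0 m m.zero_le)) (tensor x (mk (Diagram.id m)))) (mk (caps 0 m m.zero_le))

/-- The Kauffman bracket of an element `x` of the skein module of the disc without marked points:
the scalar `c` for which `x` is `c` times the empty diagram. -/
def bracket (x : TL 0) : QA := Classical.epsilon fun c => x = c • mk (Diagram.id 0)

/-- `θ(n, n, 2i)`: the bracket of the planar theta graph with edges colored `n`, `n` and `2i`. -/
def θ (n i : ℕ) (h : i ≤ n) : QA :=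
  bracket (planeClosure (comp (jonesWenzl (i + i))
    (comp (mk (cups i n h)) (comp (twoBoxes n) (mk (caps i n h))))))

/-- `z ^ k`: the class of `k` parallel copies of the core of the annulus. -/
def zPow (k : ℕ) : AnnularSkein := mkClosure (Diagram.id k)

/-- The Chebyshev element `S_j(z)`, with `S_0 = 1`, `S_1 = z`, `S_{j+2} = z S_{j+1} - S_j`. -/
def chebyshev (j : ℕ) : AnnularSkein :=
  (Polynomial.Chebyshev.S QA (j : ℤ)).sum fun k c => c • zPow k

end

end KauffmanSkein

/-!
The annulus part rests on two facts about `𝒮(S¹ × I)`. It is spanned by the powers `z ^ k` of the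
core: in the disc every diagram is a combination of diagrams that consist of local maxima followed
by local minima (`capCup_induction`), and rotating the annulus turns the closure of such a diagram
into the closure of a diagram on fewer strands (`STC_mem_range`). The powers are independent: the
two-dimensional representation of the Temperley-Lieb category, with traces weighted by `t ^ ±1` on
each strand, gives link invariants in the solid torus that send `z` to `t + t⁻¹` for every `t ≠ 0`
(`traceFunctional`), so that a polynomial relation for `z` has infinitely many roots. As the
Chebyshev polynomial `S_j` has degree `j`, the Chebyshev elements form a basis (`chebyshevBasis`),
and Wenzl's recursion, closed up around the annulus, shows that `S_j` is the closure of `f^{(j)}`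
(`STC_jonesWenzl`).

For the colored Temperley-Lieb module, `f^{(n)} ⊗ f^{(n)}` kills every system of local maxima or
minima except the nested ones between the two boxes, hence the module is spanned by `n + 1`
elements (`coloredTL_le_span`). The closure of `B_{n,i}` is obtained by rotating the annulus so
that the two vertices meet along their edges colored `n`. Removing the arcs between the boxes one
at a time, by Wenzl's recursion for the left box and its mirror image for the right one
(`middle_closure`, `vertex_succ_mul_C`), leaves a nonzero multiple of `f^{(2i)}`, the factors
being `-[2i + k + 1] [k] / [i + k]²` (`arcFactor_eq`). The same factor turns the bracket `Δ_{2i}`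
of a circle colored `2i` into `θ(n, n, 2i)` (`θ_eq`). So the closures of `B_{n,0}, …, B_{n,n}` are
nonzero multiples of distinct members of a basis; therefore these `n + 1` elements are
independent, form a basis, and the closure map is injective.

Identities between elements of skein modules of the disc are checked in a single algebra
`StableSkein`, in which every diagram is continued by infinitely many vertical strands on the
right and the numbers of end points are forgotten. Nothing is lost (`ι_injective`), because
closing an added strand multiplies by `δ ≠ 0`.
-/

namespace KauffmanSkein

/-! ### Typing of words of slices -/

theorem isDiagram_append {u v : List Slice} {n : ℕ} :
    ∀ {m : ℕ}, IsDiagram m (u ++ v) n ↔ ∃ k, IsDiagram m u k ∧ IsDiagram k v n := by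
  induction u with
  | nil => intro m; exact ⟨fun h => ⟨m, rfl, h⟩, fun ⟨k, h, h'⟩ => by cases h; exact h'⟩
  | cons s u ih =>
    intro m
    simp only [List.cons_append, IsDiagram, ih]
    exact ⟨fun ⟨h, k, h1, h2⟩ => ⟨k, ⟨h, h1⟩, h2⟩, fun ⟨k, ⟨h, h1⟩, h2⟩ => ⟨h, k, h1, h2⟩⟩

theorem IsDiagram.target_unique {w : List Slice} {n n' : ℕ} :
    ∀ {m : ℕ}, IsDiagram m w n → IsDiagram m w n' → n = n' := by
  induction w with
  | nil => intro m h h'; exact h.symm.trans h'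
  | cons s w ih => intro m h h'; exact ih h.2 h'.2

theorem IsDiagram.source_unique {w : List Slice} {n : ℕ} :
    ∀ {m m' : ℕ}, IsDiagram m w n → IsDiagram m' w n → m = m' := by
  induction w with
  | nil => intro m m' h h'; exact Eq.trans h (Eq.symm h')
  | cons s w ih =>
    intro m m' h h'
    have := ih h.2 h'.2
    have h1 := h.1
    have h2 := h'.1
    omega

/-- Every word of slices is a diagram on sufficiently many strands. -/
theorem exists_isDiagram (w : List Slice) (K : ℕ) :
    ∃ M₀, ∀ M ≥ M₀, ∃ N ≥ K, IsDiagram M w N := by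
  induction w with
  | nil => exact ⟨K, fun M hM => ⟨M, hM, rfl⟩⟩
  | cons s w ih =>
    obtain ⟨M₀, h⟩ := ih
    refine ⟨M₀ + s.pos + s.kind.ins, fun M hM => ?_⟩
    obtain ⟨N, hN, hw⟩ := h (M - s.kind.ins + s.kind.outs) (by omega)
    exact ⟨N, hN, by omega, hw⟩

noncomputable section

/-! ### The ground field -/

theorem A_ne_zero : A ≠ 0 := RatFunc.X_ne_zero

theorem A_pow_ne_one {k : ℕ} (hk : k ≠ 0) : A ^ k ≠ 1 := by
  intro h
  have h2 : (algebraMap (Polynomial ℚ) QA) (Polynomial.X ^ k) = algebraMap (Polynomial ℚ) QA 1 := by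
    rw [map_pow, RatFunc.algebraMap_X, map_one]
    exact h
  have h3 := congrArg Polynomial.natDegree (RatFunc.algebraMap_injective ℚ h2)
  rw [Polynomial.natDegree_X_pow, Polynomial.natDegree_one] at h3
  exact hk h3

theorem δ_ne_zero : δ ≠ 0 := by
  intro h
  have hA := A_ne_zero
  rw [δ] at h
  field_simp at h
  refine A_pow_ne_one (k := 8) (by norm_num) ?_
  linear_combination (-A ^ 4 + 1) * h

/-! ### The stable skein algebra -/

/-- Formal linear combinations of words of slices, multiplied by stacking; the left factor is the
lower one. -/
abbrev WordAlgebra : Type := MonoidAlgebra QA (FreeMonoid Slice)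

/-- A well-typed word of slices as a diagram. -/
def diag {m n : ℕ} (w : List Slice) (h : IsDiagram m w n) : Diagram m n := ⟨w, h⟩

@[simp] theorem diag_val {m n : ℕ} (w : List Slice) (h : IsDiagram m w n) : (diag w h).1 = w := rfl

open Classical in
/-- The class of a word in the skein module with `M` lower and `N` upper end points; zero if the
word is not a diagram with these end points. -/
def wordClass (M N : ℕ) (w : List Slice) : Skein M N :=
  if h : IsDiagram M w N then mk (diag w h) else 0

theorem wordClass_of {M N : ℕ} {w : List Slice} (h : IsDiagram M w N) :
    wordClass M N w = mk (diag w h) := dif_pos h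

theorem wordClass_of_not {M N : ℕ} {w : List Slice} (h : ¬ IsDiagram M w N) :
    wordClass M N w = 0 := dif_neg h

/-- The linear extension of `wordClass`. -/
def ev (M N : ℕ) : WordAlgebra →ₗ[QA] Skein M N :=
  (Finsupp.linearCombination QA fun w : FreeMonoid Slice => wordClass M N w.toList) ∘ₗ
    (MonoidAlgebra.coeffLinearEquiv QA).toLinearMap

theorem ev_single (M N : ℕ) (w : FreeMonoid Slice) (c : QA) :
    ev M N (MonoidAlgebra.single w c) = c • wordClass M N w.toList := by
  simp [ev, MonoidAlgebra.coeffLinearEquiv]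

@[simp] theorem comp_mk {m n k : ℕ} (D : Diagram m n) (E : Diagram n k) :
    comp (mk D) (mk E) = mk (D.comp E) := by
  simp [comp]

@[simp] theorem tensor_mk {m n m' n' : ℕ} (D : Diagram m n) (E : Diagram m' n') :
    tensor (mk D) (mk E) = mk (D.tensor E) := by
  simp [tensor]

theorem wordAlgebra_induction {p : WordAlgebra → Prop} (x : WordAlgebra) (h0 : p 0)
    (hadd : ∀ x y, p x → p y → p (x + y))
    (hs : ∀ w c, p (MonoidAlgebra.single w c)) : p x := by
  obtain ⟨f⟩ := x
  induction f using Finsupp.induction_linear with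
  | zero => exact h0
  | add f g hf hg => exact hadd _ _ hf hg
  | single w c => exact hs w c

theorem ev_single_mul {M M' : ℕ} (N : ℕ) {w : FreeMonoid Slice} (h : IsDiagram M w.toList M')
    (c : QA) (y : WordAlgebra) :
    ev M N (MonoidAlgebra.single w c * y) = c • comp (mk (diag w.toList h)) (ev M' N y) := by
  induction y using wordAlgebra_induction with
  | h0 => simp
  | hadd x y hx hy => rw [mul_add, map_add, hx, hy, map_add, map_add, smul_add]
  | hs v d =>
    rw [MonoidAlgebra.single_mul_single, ev_single, ev_single, map_smul, smul_smul,
      FreeMonoid.toList_mul]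
    congr 1
    by_cases hv : IsDiagram M' v.toList N
    · rw [wordClass_of hv, wordClass_of (h.append hv), comp_mk]
      rfl
    · rw [wordClass_of_not hv, wordClass_of_not, map_zero]
      intro h'
      obtain ⟨k, h1, h2⟩ := isDiagram_append.1 h'
      cases h.target_unique h1
      exact hv h2

theorem ev_mul_single {K N : ℕ} (M : ℕ) {w : FreeMonoid Slice} (h : IsDiagram K w.toList N)
    (c : QA) (y : WordAlgebra) :
    ev M N (y * MonoidAlgebra.single w c) = c • comp (ev M K y) (mk (diag w.toList h)) := by
  induction y using wordAlgebra_induction with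
  | h0 => simp
  | hadd x y hx hy =>
    rw [add_mul, map_add, hx, hy, map_add, map_add, LinearMap.add_apply, smul_add]
  | hs v d =>
    rw [MonoidAlgebra.single_mul_single, ev_single, ev_single, map_smul, LinearMap.smul_apply,
      smul_smul, FreeMonoid.toList_mul, mul_comm]
    congr 1
    by_cases hv : IsDiagram M v.toList K
    · rw [wordClass_of hv, wordClass_of (hv.append h), comp_mk]
      rfl
    · rw [wordClass_of_not hv, wordClass_of_not, map_zero, LinearMap.zero_apply]
      intro h'
      obtain ⟨k, h1, h2⟩ := isDiagram_append.1 h'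
      cases h.source_unique h2
      exact hv h1

theorem ev_mul_single_of_not {N : ℕ} (M : ℕ) {w : FreeMonoid Slice}
    (h : ∀ K, ¬ IsDiagram K w.toList N) (c : QA) (y : WordAlgebra) :
    ev M N (y * MonoidAlgebra.single w c) = 0 := by
  induction y using wordAlgebra_induction with
  | h0 => simp
  | hadd x y hx hy => rw [add_mul, map_add, hx, hy, add_zero]
  | hs v d =>
    rw [MonoidAlgebra.single_mul_single, ev_single, FreeMonoid.toList_mul, wordClass_of_not,
      smul_zero]
    intro h'
    obtain ⟨k, h1, h2⟩ := isDiagram_append.1 h'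
    exact h k h2

/-- The two-sided ideal of the combinations of words that vanish in the skein modules as soon as
there are enough vertical strands on the right. -/
def stableIdeal : TwoSidedIdeal WordAlgebra :=
  TwoSidedIdeal.mk' {p | ∃ M₀, ∀ M ≥ M₀, ∀ N, ev M N p = 0}
    ⟨0, by simp⟩
    (by
      rintro x y ⟨a, ha⟩ ⟨b, hb⟩
      exact ⟨max a b, fun M hM N => by
        rw [map_add, ha M (by omega), hb M (by omega), add_zero]⟩)
    (by
      rintro x ⟨a, ha⟩
      exact ⟨a, fun M hM N => by rw [map_neg, ha M hM, neg_zero]⟩)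
    (by
      rintro x y ⟨a, ha⟩
      induction x using wordAlgebra_induction with
      | h0 => exact ⟨0, by simp⟩
      | hadd x x' hx hx' =>
        obtain ⟨b, hb⟩ := hx
        obtain ⟨c, hc⟩ := hx'
        exact ⟨max b c, fun M hM N => by
          rw [add_mul, map_add, hb M (by omega), hc M (by omega), add_zero]⟩
      | hs w c =>
        obtain ⟨b, hb⟩ := exists_isDiagram w.toList a
        refine ⟨b, fun M hM N => ?_⟩
        obtain ⟨M', hM', hw⟩ := hb M hM
        rw [ev_single_mul N hw, ha M' hM', map_zero, smul_zero])
    (by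
      rintro x y ⟨a, ha⟩
      refine ⟨a, fun M hM N => ?_⟩
      induction y using wordAlgebra_induction with
      | h0 => simp
      | hadd y y' hy hy' => rw [mul_add, map_add, hy, hy', add_zero]
      | hs w c =>
        by_cases h : ∃ K, IsDiagram K w.toList N
        · obtain ⟨K, hK⟩ := h
          rw [ev_mul_single M hK, ha M hM, map_zero, LinearMap.zero_apply, smul_zero]
        · exact ev_mul_single_of_not M (not_exists.1 h) c x)

/-- The stable skein algebra: words of slices modulo the relations that hold in the skein modules of
the disc once enough vertical strands are added on the right. All skein modules of the disc embed
into it (`ι_injective`), so that identities between their elements can be checked without keeping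
track of the numbers of end points. -/
def StableSkein : Type := stableIdeal.ringCon.Quotient

instance : Ring StableSkein := inferInstanceAs (Ring stableIdeal.ringCon.Quotient)

instance : Algebra QA StableSkein := inferInstanceAs (Algebra QA stableIdeal.ringCon.Quotient)

/-- The quotient map onto the stable skein algebra. -/
def toStable : WordAlgebra →ₐ[QA] StableSkein := stableIdeal.ringCon.mkₐ QA

/-- The class of a word in the stable skein algebra. -/
def W (w : List Slice) : StableSkein :=
  toStable (MonoidAlgebra.single (FreeMonoid.ofList w) 1)

theorem W_nil : W [] = 1 := rfl

theorem W_append (u v : List Slice) : W (u ++ v) = W u * W v := by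
  unfold W
  rw [← map_mul, MonoidAlgebra.single_mul_single, mul_one, FreeMonoid.ofList_append]

theorem W_cons (s : Slice) (v : List Slice) : W (s :: v) = W [s] * W v := W_append [s] v

theorem toStable_eq_iff {p q : WordAlgebra} :
    toStable p = toStable q ↔ ∃ M₀, ∀ M ≥ M₀, ∀ N, ev M N p = ev M N q := by
  refine (RingCon.eq _).trans ?_
  rw [TwoSidedIdeal.rel_iff, stableIdeal, TwoSidedIdeal.mem_mk']
  simp only [Set.mem_ofPred_eq, map_sub, sub_eq_zero]

theorem Move.isDiagram_iff {l r : List Slice} (h : Move l r) :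
    ∃ M₀, ∀ M ≥ M₀, ∀ N, IsDiagram M l N ↔ IsDiagram M r N := by
  cases h with
  | exchange x y i d =>
    refine ⟨i + x.ins + d + y.ins + 4, fun M hM N => ?_⟩
    simp only [IsDiagram]
    omega
  | _ i =>
    refine ⟨i + 8, fun M hM N => ?_⟩
    simp only [IsDiagram, cup, cap, overX, underX, Kind.ins, Kind.outs]
    omega

theorem W_move {l r : List Slice} (h : Move l r) : W l = W r := by
  obtain ⟨M₀, h0⟩ := h.isDiagram_iff
  refine toStable_eq_iff.2 ⟨M₀, fun M hM N => ?_⟩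
  rw [ev_single, ev_single]
  congr 1
  by_cases hl : IsDiagram M l N
  · have hr := (h0 M hM N).1 hl
    rw [FreeMonoid.toList_ofList, FreeMonoid.toList_ofList, wordClass_of hl, wordClass_of hr]
    exact mk_step ⟨[], [], l, r, h, by simp, by simp⟩
  · have hr := fun h => hl ((h0 M hM N).2 h)
    rw [FreeMonoid.toList_ofList, FreeMonoid.toList_ofList, wordClass_of_not hl,
      wordClass_of_not hr]

theorem W_overX (i : ℕ) : W [overX i] = A • 1 + A⁻¹ • (W [cap i] * W [cup i]) := by
  rw [← W_append, ← W_nil]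
  unfold W
  rw [← map_smul, ← map_smul, ← map_add]
  refine toStable_eq_iff.2 ⟨i + 2, fun M hM N => ?_⟩
  rw [map_add, map_smul, map_smul, ev_single, ev_single, ev_single, one_smul, one_smul, one_smul]
  simp only [FreeMonoid.toList_ofList]
  by_cases hN : M = N
  · subst hN
    have h1 : IsDiagram M [overX i] M := by
      simp only [IsDiagram, overX, Kind.ins, Kind.outs]
      omega
    rw [wordClass_of h1, wordClass_of (w := []) rfl, wordClass_of (w := [cap i] ++ [cup i])]
    · exact mk_triple ⟨[], [], i, by simp, rfl, by simp⟩
    · simp only [List.cons_append, List.nil_append, IsDiagram, cup, cap, Kind.ins, Kind.outs]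
      omega
  · rw [wordClass_of_not, wordClass_of_not, wordClass_of_not, smul_zero, smul_zero, add_zero]
    · simp only [List.cons_append, List.nil_append, IsDiagram, cup, cap, Kind.ins, Kind.outs]
      omega
    · exact hN
    · simp only [IsDiagram, overX, Kind.ins, Kind.outs]
      omega

theorem W_circle (i : ℕ) : W [cup i] * W [cap i] = δ • 1 := by
  rw [← W_append, ← W_nil]
  unfold W
  rw [← map_smul]
  refine toStable_eq_iff.2 ⟨i + 2, fun M hM N => ?_⟩
  rw [map_smul, ev_single, ev_single, one_smul, one_smul]
  simp only [FreeMonoid.toList_ofList]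
  by_cases hN : M = N
  · subst hN
    rw [wordClass_of (w := []) rfl, wordClass_of (w := [cup i] ++ [cap i])]
    · exact mk_circle ⟨[], [], i, by simp, rfl⟩
    · simp only [List.cons_append, List.nil_append, IsDiagram, cup, cap, Kind.ins, Kind.outs]
      omega
  · rw [wordClass_of_not, wordClass_of_not, smul_zero]
    · exact hN
    · simp only [List.cons_append, List.nil_append, IsDiagram, cup, cap, Kind.ins, Kind.outs]
      omega

/-! ### Embedding of the skein modules of the disc -/

/-- The map from a skein module to the stable skein algebra that puts `k` vertical strands on the
left of a diagram and infinitely many on its right. -/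
def ι (k : ℕ) {m n : ℕ} : Skein m n →ₗ[QA] StableSkein :=
  lift (fun D => W (D.1.map (Slice.shift k)))
    (by
      rintro D D' ⟨u, v, l, r, h, h1, h2⟩
      simp only [h1, h2, List.map_append, W_append, W_move (h.map_shift k)])
    (by
      rintro D D₀ D₁ ⟨u, v, i, h, h0, h1⟩
      have e : W ([overX i].map (Slice.shift k)) =
          A • 1 + A⁻¹ • W ([cap i, cup i].map (Slice.shift k)) :=
        (W_overX (k + i)).trans (by rw [← W_append]; rfl)
      simp only [h, h0, h1, List.map_append, W_append, e, add_mul, mul_add, smul_mul_assoc,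
        mul_smul_comm, mul_one])
    (by
      rintro D D₀ ⟨u, v, i, h, h0⟩
      have e : W ([cup i, cap i].map (Slice.shift k)) = δ • 1 :=
        (by rw [← W_append]; rfl : _ = W [cup (k + i)] * W [cap (k + i)]).trans (W_circle (k + i))
      simp only [h, h0, List.map_append, W_append, e, smul_mul_assoc, mul_smul_comm, mul_one])

theorem ι_mk (k : ℕ) {m n : ℕ} (D : Diagram m n) : ι k (mk D) = W (D.1.map (Slice.shift k)) :=
  lift_mk _ _ _ _ _

theorem map_shift_zero (w : List Slice) : w.map (Slice.shift 0) = w := by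
  have : Slice.shift 0 = _root_.id := by
    funext s
    simp [Slice.shift]
  rw [this, List.map_id]

theorem map_shift_shift (k l : ℕ) (w : List Slice) :
    (w.map (Slice.shift l)).map (Slice.shift k) = w.map (Slice.shift (k + l)) := by
  simp [Slice.shift, Function.comp_def, add_assoc]

theorem ι_zero_mk {m n : ℕ} (D : Diagram m n) : ι 0 (mk D) = W D.1 := by
  rw [ι_mk, map_shift_zero]

theorem skein_induction {m n : ℕ} {p : Skein m n → Prop} (x : Skein m n)
    (h0 : p 0) (hmk : ∀ D, p (mk D)) (hadd : ∀ x y, p x → p y → p (x + y))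
    (hsmul : ∀ (c : QA) x, p x → p (c • x)) : p x := by
  obtain ⟨f, rfl⟩ := Submodule.mkQ_surjective _ x
  induction f using Finsupp.induction_linear with
  | zero => rwa [map_zero]
  | add f g hf hg => rw [map_add]; exact hadd _ _ hf hg
  | single t c =>
    induction t using Quot.ind with
    | mk D =>
      have := hsmul c _ (hmk D)
      rwa [mk, tangle, ← map_smul, Finsupp.smul_single, smul_eq_mul, mul_one] at this

theorem ι_comp (k : ℕ) {m n l : ℕ} (x : Skein m n) (y : Skein n l) :
    ι k (comp x y) = ι k x * ι k y := by
  induction x using skein_induction with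
  | h0 => simp
  | hadd x x' hx hx' => simp only [map_add, LinearMap.add_apply, hx, hx', add_mul]
  | hsmul c x hx => simp only [map_smul, LinearMap.smul_apply, hx, smul_mul_assoc]
  | hmk D =>
    induction y using skein_induction with
    | h0 => simp
    | hadd y y' hy hy' => simp only [map_add, hy, hy', mul_add]
    | hsmul c y hy => simp only [map_smul, hy, mul_smul_comm]
    | hmk E => rw [comp_mk, ι_mk, ι_mk, ι_mk, ← W_append, Diagram.comp, List.map_append]

theorem ι_tensor (k : ℕ) {m n m' n' : ℕ} (x : Skein m n) (y : Skein m' n') :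
    ι k (tensor x y) = ι k x * ι (k + n) y := by
  induction x using skein_induction with
  | h0 => simp
  | hadd x x' hx hx' => simp only [map_add, LinearMap.add_apply, hx, hx', add_mul]
  | hsmul c x hx => simp only [map_smul, LinearMap.smul_apply, hx, smul_mul_assoc]
  | hmk D =>
    induction y using skein_induction with
    | h0 => simp
    | hadd y y' hy hy' => simp only [map_add, hy, hy', mul_add]
    | hsmul c y hy => simp only [map_smul, hy, mul_smul_comm]
    | hmk E =>
      rw [tensor_mk, ι_mk, ι_mk, ι_mk, ← W_append, Diagram.tensor, List.map_append,
        map_shift_shift]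

theorem ι_id (k n : ℕ) : ι k (mk (Diagram.id n)) = 1 := (ι_mk k _).trans W_nil

/-- A local minimum far to the right may be moved upwards past a whole diagram. -/
theorem mk_cup_cons {m n : ℕ} (w : List Slice) (hw : IsDiagram m w n) (a b : ℕ) (u v : List Slice)
    (hu : IsDiagram a u m) (hv : IsDiagram (n + 2) v b)
    (h : IsDiagram a (u ++ cup m :: (w ++ v)) b)
    (h' : IsDiagram a (u ++ (w ++ cup n :: v)) b) :
    mk (diag _ h) = mk (diag _ h') := by
  induction w generalizing m u with
  | nil => cases hw; rfl
  | cons s w ih =>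
    obtain ⟨hs, hw⟩ := hw
    set m' := m - s.kind.ins + s.kind.outs with hm'
    have hu' : IsDiagram a (u ++ [s]) m' := hu.append ⟨hs, rfl⟩
    have h1 : IsDiagram a (u ++ [s] ++ cup m' :: (w ++ v)) b := by
      refine hu'.append ⟨by simp [cup, Kind.ins], ?_⟩
      simp only [cup, Kind.ins, Kind.outs, Nat.sub_zero]
      exact (hw.addRight 2).append hv
    have h2 : IsDiagram a (u ++ [s] ++ (w ++ cup n :: v)) b := by
      simpa using h'
    have h3 : mk (diag _ h2) = mk (diag _ h') := by
      congr 2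
      simp
    rw [← h3, ← ih hw (u ++ [s]) hu' h1 h2]
    refine (mk_step ⟨u, w ++ v, _, _, Move.exchange s.kind .cup s.pos (m - s.pos - s.kind.ins),
      ?_, ?_⟩).symm
    · simp only [diag, List.append_assoc, List.cons_append, List.nil_append, cup]
      have : m' = s.pos + s.kind.outs + (m - s.pos - s.kind.ins) := by omega
      rw [this]
    · simp only [diag, List.append_assoc, List.cons_append, List.nil_append, cup]
      have : m = s.pos + s.kind.ins + (m - s.pos - s.kind.ins) := by omega
      rw [← this]

/-- Closing the rightmost strand of a diagram followed by a vertical strand adds a circle; hence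
adding a vertical strand on the right is injective. -/
theorem tensor_id_one_injective {m n : ℕ} {x : Skein m n}
    (h : tensor x (mk (Diagram.id 1)) = 0) : x = 0 := by
  have hc : IsDiagram m [cup m] (m + 1 + 1) := ⟨by simp [cup, Kind.ins], rfl⟩
  have hd : IsDiagram (n + 1 + 1) [cap n] n := ⟨by simp [cap, Kind.ins], by
    simp [IsDiagram, cap, Kind.ins, Kind.outs]⟩
  have key : ∀ y : Skein m n, comp (mk (diag _ hc))
      (comp (tensor (tensor y (mk (Diagram.id 1))) (mk (Diagram.id 1))) (mk (diag _ hd))) =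
      δ • y := by
    intro y
    induction y using skein_induction with
    | h0 => simp
    | hadd y y' hy hy' => simp only [map_add, LinearMap.add_apply, hy, hy', smul_add]
    | hsmul c y hy => 
      simp only [map_smul, LinearMap.smul_apply, hy]
      exact smul_comm _ _ _
    | hmk D =>
      simp only [tensor_mk, comp_mk]
      have h1 : IsDiagram m ([] ++ cup m :: (D.1 ++ [cap n])) n :=
        hc.append ((D.2.addRight 2).append hd)
      have h2 : IsDiagram m ([] ++ (D.1 ++ cup n :: [cap n])) n := by
        refine D.2.append ?_
        simp [IsDiagram, cap, cup, Kind.ins, Kind.outs]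
      rw [← mk_circle (D := diag _ h2) (D₀ := D) ⟨D.1, [], n, by simp [diag], by simp⟩,
        ← mk_cup_cons D.1 D.2 m n [] [cap n] rfl hd h1 h2]
      congr 1
      apply Subtype.ext
      simp [Diagram.comp, Diagram.tensor, Diagram.id, diag]
  have := key x
  rw [h] at this
  simp only [map_zero, LinearMap.zero_apply] at this
  exact (smul_eq_zero.1 this.symm).resolve_left δ_ne_zero

theorem tensor_id_injective {m n : ℕ} {x : Skein m n} (r : ℕ)
    (h : tensor x (mk (Diagram.id r)) = 0) : x = 0 := by
  induction r with
  | zero =>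
    have key : ∀ y : Skein m n, tensor y (mk (Diagram.id 0)) = y := by
      intro y
      induction y using skein_induction with
      | h0 => simp
      | hadd y y' hy hy' => simp only [map_add, LinearMap.add_apply, hy, hy']
      | hsmul c y hy => simp only [map_smul, LinearMap.smul_apply, hy]
      | hmk D =>
        rw [tensor_mk]
        congr 1
        apply Subtype.ext
        simp [Diagram.tensor, Diagram.id]
    rwa [key] at h
  | succ r ih =>
    refine ih (tensor_id_one_injective ?_)
    rw [← h]
    have key : ∀ y : Skein m n, tensor (tensor y (mk (Diagram.id r))) (mk (Diagram.id 1)) =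
        tensor y (mk (Diagram.id (r + 1))) := by
      intro y
      induction y using skein_induction with
      | h0 => simp
      | hadd y y' hy hy' => simp only [map_add, LinearMap.add_apply, hy, hy']
      | hsmul c y hy => simp only [map_smul, LinearMap.smul_apply, hy]
      | hmk D =>
        simp only [tensor_mk]
        congr 1
        apply Subtype.ext
        simp [Diagram.tensor, Diagram.id]
    exact key x

/-- A skein element is represented by a combination of words whose value with `r` more strands on the
right is the element with these strands added. -/
theorem exists_representative {m n : ℕ} (x : Skein m n) :
    ∃ p : WordAlgebra, ι 0 x = toStable p ∧
      ∀ r, ev (m + r) (n + r) p = tensor x (mk (Diagram.id r)) := by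
  induction x using skein_induction with
  | h0 => exact ⟨0, by simp, by simp⟩
  | hadd x y hx hy =>
    obtain ⟨p, hp, hp'⟩ := hx
    obtain ⟨q, hq, hq'⟩ := hy
    exact ⟨p + q, by rw [map_add, hp, hq, map_add], fun r => by
      rw [map_add, hp', hq', map_add, LinearMap.add_apply]⟩
  | hsmul c x hx =>
    obtain ⟨p, hp, hp'⟩ := hx
    exact ⟨c • p, by rw [map_smul, hp, map_smul], fun r => by
      rw [map_smul, hp', map_smul, LinearMap.smul_apply]⟩
  | hmk D =>
    refine ⟨MonoidAlgebra.single (FreeMonoid.ofList D.1) 1, ι_zero_mk D, fun r => ?_⟩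
    rw [ev_single, one_smul, tensor_mk, FreeMonoid.toList_ofList, wordClass_of (D.2.addRight r)]
    congr 1
    apply Subtype.ext
    simp [Diagram.tensor, Diagram.id, diag]

/-- The skein modules of the disc embed into the stable skein algebra. -/
theorem ι_injective {m n : ℕ} : Function.Injective (ι 0 : Skein m n → StableSkein) := by
  refine (injective_iff_map_eq_zero (ι 0)).2 fun x hx => ?_
  obtain ⟨p, hp, hp'⟩ := exists_representative x
  rw [hp, ← map_zero toStable, toStable_eq_iff] at hx
  obtain ⟨M₀, h⟩ := hx
  refine tensor_id_injective M₀ ?_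
  rw [← hp', h _ (by omega), map_zero]


/-! ### Quantum integers -/

/-- The quantum integer `[n]` times `A² - A⁻²`. -/
def qInt (n : ℕ) : QA := A ^ (2 * n) - A⁻¹ ^ (2 * n)

/-- The coefficient `Δ_{n-1} / Δ_n` in Wenzl's recursion, which is `0` for `n = 0`. -/
def ratio : ℕ → QA
  | 0 => 0
  | n + 1 => Δ n / Δ (n + 1)

theorem qInt_ne_zero {n : ℕ} (hn : n ≠ 0) : qInt n ≠ 0 := by
  have hA := A_ne_zero
  intro h
  rw [qInt, inv_pow, sub_eq_zero] at h
  refine A_pow_ne_one (k := 4 * n) (by omega) ?_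
  have h2 : A ^ (2 * n) ≠ 0 := pow_ne_zero _ hA
  calc A ^ (4 * n) = A ^ (2 * n) * A ^ (2 * n) := by ring
    _ = 1 := by nth_rewrite 1 [h]; exact inv_mul_cancel₀ h2

theorem qInt_zero : qInt 0 = 0 := by simp [qInt]

theorem Δ_eq (n : ℕ) : Δ n = (-1) ^ n * qInt (n + 1) / qInt 1 := rfl

theorem Δ_ne_zero (n : ℕ) : Δ n ≠ 0 := by
  rw [Δ_eq]
  exact div_ne_zero (mul_ne_zero (pow_ne_zero _ (by norm_num)) (qInt_ne_zero n.succ_ne_zero))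
    (qInt_ne_zero one_ne_zero)

theorem Δ_zero : Δ 0 = 1 := by
  rw [Δ_eq, pow_zero, one_mul, zero_add, div_self (qInt_ne_zero one_ne_zero)]

theorem qInt_add_two (n : ℕ) : qInt (n + 2) = -δ * qInt (n + 1) - qInt n := by
  have hA := A_ne_zero
  simp only [qInt, δ, inv_pow, mul_add, pow_add]
  field_simp
  ring

theorem ratio_eq (n : ℕ) : ratio n = -qInt n / qInt (n + 1) := by
  cases n with
  | zero => simp [ratio, qInt_zero]
  | succ n =>
    have h1 := qInt_ne_zero one_ne_zero
    have h2 := qInt_ne_zero (n + 1).succ_ne_zero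
    have h3 : (-1 : QA) ^ n ≠ 0 := pow_ne_zero _ (by norm_num)
    rw [ratio, Δ_eq, Δ_eq, pow_succ]
    field_simp

theorem δ_sub_ratio (n : ℕ) : δ - ratio n = Δ (n + 1) / Δ n := by
  have h1 := qInt_ne_zero one_ne_zero
  have h2 := qInt_ne_zero n.succ_ne_zero
  have h3 : (-1 : QA) ^ n ≠ 0 := pow_ne_zero _ (by norm_num)
  rw [ratio_eq, Δ_eq, Δ_eq, pow_succ, qInt_add_two]
  field_simp
  ring

theorem ratio_mul (n : ℕ) : ratio (n + 1) * (Δ (n + 1) / Δ n) = 1 := by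
  have h1 := Δ_ne_zero n
  have h2 := Δ_ne_zero (n + 1)
  rw [ratio]
  field_simp

/-! ### Temperley-Lieb relations in the stable skein algebra -/

/-- The local minimum with `i` strands on its left. -/
def U (i : ℕ) : StableSkein := W [cup i]

/-- The local maximum with `i` strands on its left. -/
def C (i : ℕ) : StableSkein := W [cap i]

theorem mul_mul_of_mul_eq {R : Type*} [Semigroup R] {a b c : R} (h : a * b = c) (x : R) :
    a * (b * x) = c * x := by
  rw [← mul_assoc, h]

theorem U_mul_C (i : ℕ) : U i * C i = δ • 1 := W_circle i

theorem U_mul_C_succ (i : ℕ) : U i * C (i + 1) = 1 := by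
  rw [U, C, ← W_append, ← W_nil]
  exact W_move (Move.snake_left i)

theorem U_succ_mul_C (i : ℕ) : U (i + 1) * C i = 1 := by
  rw [U, C, ← W_append, ← W_nil]
  exact W_move (Move.snake_right i)

/-- Diagrams lying side by side may exchange their heights. -/
theorem W_exchange {m n : ℕ} {w : List Slice} (hw : IsDiagram m w n) (k d : ℕ) (v : List Slice) :
    W (w.map (Slice.shift k)) * W (v.map (Slice.shift (k + n + d))) =
      W (v.map (Slice.shift (k + m + d))) * W (w.map (Slice.shift k)) := by
  have one : ∀ s : Slice, W (w.map (Slice.shift k)) * W [s.shift (k + n + d)] =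
      W [s.shift (k + m + d)] * W (w.map (Slice.shift k)) := by
    intro s
    induction w generalizing m with
    | nil => cases hw; rw [List.map_nil, W_nil, one_mul, mul_one]
    | cons t w ih =>
      obtain ⟨ht, hw⟩ := hw
      have := W_move (Move.exchange t.kind s.kind (k + t.pos) (m - t.pos - t.kind.ins + d + s.pos))
      rw [W_cons ⟨t.kind, _⟩ [_], W_cons ⟨s.kind, _⟩ [_]] at this
      rw [List.map_cons, W_cons, mul_assoc, ih hw, ← mul_assoc, ← mul_assoc]
      congr 1
      have e1 : Slice.shift (k + (m - t.kind.ins + t.kind.outs) + d) s =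
          ⟨s.kind, k + t.pos + t.kind.outs + (m - t.pos - t.kind.ins + d + s.pos)⟩ := by
        simp only [Slice.shift, Slice.mk.injEq, true_and]
        omega
      have e2 : Slice.shift (k + m + d) s =
          ⟨s.kind, k + t.pos + t.kind.ins + (m - t.pos - t.kind.ins + d + s.pos)⟩ := by
        simp only [Slice.shift, Slice.mk.injEq, true_and]
        omega
      rw [e1, e2]
      exact this
  induction v with
  | nil => rw [List.map_nil, List.map_nil, W_nil, one_mul, mul_one]
  | cons s v ih =>
    rw [List.map_cons, List.map_cons, W_cons, W_cons (s.shift (k + m + d)), ← mul_assoc, one,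
      mul_assoc, ih, mul_assoc]

theorem ι_exchange {m n m' n' : ℕ} (x : Skein m n) (y : Skein m' n') (k d : ℕ) :
    ι k x * ι (k + n + d) y = ι (k + m + d) y * ι k x := by
  induction x using skein_induction with
  | h0 => simp
  | hadd x x' hx hx' => simp only [map_add, hx, hx', add_mul, mul_add]
  | hsmul c x hx => simp only [map_smul, hx, smul_mul_assoc, mul_smul_comm]
  | hmk D =>
    induction y using skein_induction with
    | h0 => simp
    | hadd y y' hy hy' => simp only [map_add, hy, hy', mul_add, add_mul]
    | hsmul c y hy => simp only [map_smul, hy, mul_smul_comm, smul_mul_assoc]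
    | hmk E => simp only [ι_mk]; exact W_exchange D.2 k d E.1

/-- A single local minimum. -/
def cupDiagram : Diagram 0 2 := diag [cup 0] ⟨by simp [cup, Kind.ins], rfl⟩

/-- A single local maximum. -/
def capDiagram : Diagram 2 0 := diag [cap 0] ⟨by simp [cap, Kind.ins], rfl⟩

theorem ι_cup (k : ℕ) : ι k (mk cupDiagram) = U k := ι_mk k _

theorem ι_cap (k : ℕ) : ι k (mk capDiagram) = C k := ι_mk k _

theorem U_mul_ι {m n : ℕ} (a d : ℕ) (y : Skein m n) :
    U a * ι (a + 2 + d) y = ι (a + d) y * U a := by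
  rw [← ι_cup]
  exact ι_exchange (mk cupDiagram) y a d

theorem C_mul_ι {m n : ℕ} (a d : ℕ) (y : Skein m n) :
    C a * ι (a + d) y = ι (a + 2 + d) y * C a := by
  rw [← ι_cap]
  exact ι_exchange (mk capDiagram) y a d

theorem ι_mul_U {m n : ℕ} (k d : ℕ) (x : Skein m n) :
    ι k x * U (k + n + d) = U (k + m + d) * ι k x := by
  rw [← ι_cup, ← ι_cup]
  exact ι_exchange x _ k d

theorem ι_mul_C {m n : ℕ} (k d : ℕ) (x : Skein m n) :
    ι k x * C (k + n + d) = C (k + m + d) * ι k x := by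
  rw [← ι_cap, ← ι_cap]
  exact ι_exchange x _ k d

theorem U_mul_C_far (i d : ℕ) : U i * C (i + 2 + d) = C (i + d) * U i := by
  rw [← ι_cap, ← ι_cap]
  exact U_mul_ι i d _

theorem U_far_mul_C (i d : ℕ) : U (i + 2 + d) * C i = C i * U (i + d) := by
  rw [← ι_cup, ← ι_cup]
  exact (C_mul_ι i d _).symm

theorem U_mul_U (i d : ℕ) : U i * U (i + 2 + d) = U (i + d) * U i := by
  rw [← ι_cup (i + 2 + d), ← ι_cup (i + d)]
  exact U_mul_ι i d _

/-! ### Jones-Wenzl projectors -/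

/-- The Jones-Wenzl projector on the strands `k, …, k + n - 1` in the stable skein algebra. -/
def jw (k n : ℕ) : StableSkein := ι k (jonesWenzl n)

theorem jw_zero (k : ℕ) : jw k 0 = 1 := by rw [jw, jonesWenzl, ι_id]

theorem jw_one (k : ℕ) : jw k 1 = 1 := by rw [jw, jonesWenzl, ι_id]

theorem ι_hook (k n : ℕ) : ι k (mk (hook n)) = C (k + n) * U (k + n) := by
  rw [ι_mk, C, U, ← W_append]
  rfl

theorem jw_add_two (k n : ℕ) : jw k (n + 2) = jw k (n + 1) -
    ratio (n + 1) • (jw k (n + 1) * (C (k + n) * U (k + n)) * jw k (n + 1)) := by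
  have e : ι k (tensor (jonesWenzl (n + 1)) (mk (Diagram.id 1))) = ι k (jonesWenzl (n + 1)) := by
    rw [ι_tensor, ι_id, mul_one]
  simp only [jw, jonesWenzl, map_sub, map_smul, ι_comp, ι_hook, ratio]
  rw [← e]

theorem U_mul_jw (k n d : ℕ) : U (k + n + d) * jw k n = jw k n * U (k + n + d) :=
  (ι_mul_U k d _).symm

theorem C_mul_jw (k n d : ℕ) : C (k + n + d) * jw k n = jw k n * C (k + n + d) :=
  (ι_mul_C k d _).symm

theorem jw_mul_jw_far (k n d m : ℕ) : jw k n * jw (k + n + d) m = jw (k + n + d) m * jw k n :=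
  ι_exchange _ _ k d

theorem U_mul_jw_right (a d n : ℕ) : U a * jw (a + 2 + d) n = jw (a + d) n * U a := U_mul_ι a d _

theorem C_mul_jw_right (a d n : ℕ) : C a * jw (a + d) n = jw (a + 2 + d) n * C a := C_mul_ι a d _

/-- The projector is the identity plus terms that begin with a local maximum; hence it acts as the
identity on whatever kills these. -/
theorem mul_jw_of_mul_C_eq_zero {k n : ℕ} {x : StableSkein}
    (h : ∀ i, i + 1 < n → x * C (k + i) = 0) : x * jw k n = x := by
  induction n using Nat.twoStepInduction with
  | zero => rw [jw_zero, mul_one]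
  | one => rw [jw_one, mul_one]
  | more n _ ih =>
    have h1 := ih fun i hi => h i (by omega)
    rw [jw_add_two, mul_sub, mul_smul_comm, mul_assoc, ← mul_assoc x, h1, ← mul_assoc x,
      ← mul_assoc x, h n (by omega)]
    simp

theorem jw_mul_of_U_mul_eq_zero {k n : ℕ} {x : StableSkein}
    (h : ∀ i, i + 1 < n → U (k + i) * x = 0) : jw k n * x = x := by
  induction n using Nat.twoStepInduction with
  | zero => rw [jw_zero, one_mul]
  | one => rw [jw_one, one_mul]
  | more n _ ih =>
    have h1 := ih fun i hi => h i (by omega)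
    rw [jw_add_two, sub_mul, smul_mul_assoc, mul_assoc, h1, mul_assoc, mul_assoc, h n (by omega)]
    simp

/-- Partial closure of the projector, given that the next smaller projector is idempotent. -/
theorem partial_closure_of_idempotent {k n : ℕ} (h : jw k n * jw k n = jw k n) :
    U (k + n) * jw k (n + 1) * C (k + n) = (Δ (n + 1) / Δ n) • jw k n := by
  rw [← δ_sub_ratio]
  cases n with
  | zero => rw [zero_add, jw_one, jw_zero, mul_one, add_zero, U_mul_C, ratio, sub_zero]
  | succ n =>
    have hU := U_mul_jw k (n + 1) 0
    have hC := C_mul_jw k (n + 1) 0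
    have s1 := U_succ_mul_C (k + n)
    have s2 := U_mul_C_succ (k + n)
    simp only [add_zero, ← add_assoc] at hU hC ⊢
    have e1 : U (k + n + 1) * jw k (n + 1) * C (k + n + 1) = δ • jw k (n + 1) := by
      rw [hU, mul_assoc, U_mul_C, mul_smul_comm, mul_one]
    have e2 : U (k + n + 1) * (jw k (n + 1) * (C (k + n) * U (k + n)) * jw k (n + 1)) *
        C (k + n + 1) = jw k (n + 1) := by
      simp only [mul_assoc]
      rw [← hC, mul_mul_of_mul_eq hU]
      simp only [mul_assoc]
      rw [mul_mul_of_mul_eq s1, one_mul, mul_mul_of_mul_eq s2, one_mul, h]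
    rw [jw_add_two, mul_sub, sub_mul, e1, mul_smul_comm, smul_mul_assoc, e2, sub_smul]

/-- The projector kills local maxima and minima and is idempotent. Both facts are proved together, as
the step for the first uses the partial closure, which needs the second for smaller projectors. -/
theorem jw_properties (k n : ℕ) :
    (∀ i, i + 1 < n → jw k n * C (k + i) = 0 ∧ U (k + i) * jw k n = 0) ∧
      jw k n * jw k n = jw k n := by
  induction n using Nat.twoStepInduction with
  | zero => exact ⟨fun i hi => by omega, by rw [jw_zero, one_mul]⟩
  | one => exact ⟨fun i hi => by omega, by rw [jw_one, one_mul]⟩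
  | more n ih0 ih =>
    obtain ⟨hk, hi⟩ := ih
    have hr : jw k (n + 1) * jw k n = jw k (n + 1) :=
      mul_jw_of_mul_C_eq_zero fun i hi => (hk i (by omega)).1
    have hl : jw k n * jw k (n + 1) = jw k (n + 1) :=
      jw_mul_of_U_mul_eq_zero fun i hi => (hk i (by omega)).2
    have hp := partial_closure_of_idempotent ih0.2
    have hU := U_mul_jw k n 0
    have hC := C_mul_jw k n 0
    simp only [add_zero] at hU hC
    have kill : ∀ i, i + 1 < n + 2 → jw k (n + 2) * C (k + i) = 0 ∧
        U (k + i) * jw k (n + 2) = 0 := by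
      intro i hin
      rw [jw_add_two]
      rcases Nat.lt_or_ge i n with h | h
      · have h1 := hk i (by omega)
        rw [sub_mul, mul_sub, smul_mul_assoc, mul_smul_comm, mul_assoc, h1.1, ← mul_assoc (U _),
          ← mul_assoc (U _), h1.2]
        simp
      · obtain rfl : i = n := by omega
        have e1 : jw k (i + 1) * (C (k + i) * U (k + i)) * jw k (i + 1) * C (k + i) =
            (Δ (i + 1) / Δ i) • (jw k (i + 1) * C (k + i)) := by
          rw [mul_assoc, mul_assoc, mul_assoc, ← mul_assoc (U _), hp, mul_smul_comm, hC,
            mul_smul_comm, ← mul_assoc, hr]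
        have e2 : U (k + i) * (jw k (i + 1) * (C (k + i) * U (k + i)) * jw k (i + 1)) =
            (Δ (i + 1) / Δ i) • (U (k + i) * jw k (i + 1)) := by
          rw [← mul_assoc, ← mul_assoc, ← mul_assoc, hp, smul_mul_assoc, ← hU, smul_mul_assoc,
            mul_assoc, hl]
        rw [sub_mul, mul_sub, smul_mul_assoc, mul_smul_comm, e1, e2, smul_smul, smul_smul,
          ratio_mul, one_smul, one_smul, sub_self, sub_self]
        exact ⟨rfl, rfl⟩
    exact ⟨kill, mul_jw_of_mul_C_eq_zero fun i hi => (kill i hi).1⟩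

theorem jw_mul_C {k n i : ℕ} (h : i + 1 < n) : jw k n * C (k + i) = 0 :=
  ((jw_properties k n).1 i h).1

theorem U_mul_jw_eq_zero {k n i : ℕ} (h : i + 1 < n) : U (k + i) * jw k n = 0 :=
  ((jw_properties k n).1 i h).2

theorem jw_mul_jw (k n : ℕ) : jw k n * jw k n = jw k n := (jw_properties k n).2

theorem partial_closure (k n : ℕ) :
    U (k + n) * jw k (n + 1) * C (k + n) = (Δ (n + 1) / Δ n) • jw k n :=
  partial_closure_of_idempotent (jw_mul_jw k n)

/-- A projector absorbs projectors on some of its strands. -/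
theorem jw_mul_jw_of_le {k n l m : ℕ} (h : l + m ≤ n) : jw k n * jw (k + l) m = jw k n :=
  mul_jw_of_mul_C_eq_zero fun i hi => by rw [add_assoc]; exact jw_mul_C (by omega)

theorem jw_mul_jw_of_le' {k n l m : ℕ} (h : l + m ≤ n) : jw (k + l) m * jw k n = jw k n :=
  jw_mul_of_U_mul_eq_zero fun i hi => by rw [add_assoc]; exact U_mul_jw_eq_zero (by omega)

/-- Wenzl's recursion, with the new strand on the left. -/
theorem jw_succ_left (n : ℕ) : ∀ k, jw k (n + 1) =
    jw (k + 1) n - ratio n • (jw (k + 1) n * (C k * U k) * jw (k + 1) n) := by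
  induction n with
  | zero => intro k; rw [zero_add, jw_one, jw_zero, ratio, zero_smul, sub_zero]
  | succ n ih =>
    intro k
    -- closure of the leftmost strand of the projector on `k + 1, …, k + n + 1`
    have hp : U k * jw (k + 1) (n + 1) * C k = (Δ (n + 1) / Δ n) • jw k n := by
      have hU := U_mul_jw_right k 0 n
      have hC := C_mul_jw_right k 0 n
      simp only [add_zero] at hU hC
      have e1 : U k * jw (k + 2) n * C k = δ • jw k n := by
        rw [hU, mul_assoc, U_mul_C, mul_smul_comm, mul_one]
      have e2 : U k * (jw (k + 2) n * (C (k + 1) * U (k + 1)) * jw (k + 2) n) * C k = jw k n := by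
        simp only [mul_assoc]
        rw [← hC, mul_mul_of_mul_eq hU]
        simp only [mul_assoc]
        rw [mul_mul_of_mul_eq (U_mul_C_succ k), one_mul, mul_mul_of_mul_eq (U_succ_mul_C k),
          one_mul, jw_mul_jw]
      rw [ih (k + 1), mul_sub, sub_mul, e1, mul_smul_comm, smul_mul_assoc, e2, ← sub_smul,
        δ_sub_ratio]
    set J := jw (k + 1) (n + 1) with hJ
    set M := J - ratio (n + 1) • (J * (C k * U k) * J) with hM
    have hk : ∀ i, i + 1 < n + 2 → U (k + i) * M = 0 := by
      intro i hi
      rcases Nat.eq_zero_or_pos i with rfl | h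
      · have e : U k * (J * (C k * U k) * J) = (Δ (n + 1) / Δ n) • (U k * J) := by
          have hU := U_mul_jw_right k 0 n
          simp only [add_zero] at hU
          have ha : jw (k + 2) n * J = J := jw_mul_jw_of_le' (k := k + 1) (l := 1) (by omega)
          rw [← mul_assoc, ← mul_assoc, ← mul_assoc, hp, smul_mul_assoc, ← hU, smul_mul_assoc,
            mul_assoc, ha]
        rw [hM, add_zero, mul_sub, mul_smul_comm, e, smul_smul, ratio_mul, one_smul, sub_self]
      · obtain ⟨i, rfl⟩ := Nat.exists_eq_add_of_lt h
        have h1 : U (k + (0 + i + 1)) * J = 0 := by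
          have e : k + (0 + i + 1) = k + 1 + i := by omega
          rw [e]
          exact U_mul_jw_eq_zero (by omega)
        rw [hM, mul_sub, mul_smul_comm, ← mul_assoc, ← mul_assoc, h1]
        simp
    -- the projector kills local maxima and local minima kill `M`, so the product of the two
    -- equals either of them
    have h1 : jw k (n + 2) * M = jw k (n + 2) := by
      have h2 : jw k (n + 2) * J = jw k (n + 2) := jw_mul_jw_of_le (l := 1) (by omega)
      have h3 : jw k (n + 2) * C k = 0 := jw_mul_C (i := 0) (by omega)
      rw [hM, mul_sub, mul_smul_comm, ← mul_assoc, ← mul_assoc, ← mul_assoc, h2, h3]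
      simp
    rw [← h1]
    exact jw_mul_of_U_mul_eq_zero hk


/-! ### The vertex of type `(n, n, 2i)` -/

/-- Two projectors of the same size side by side in the stable skein algebra. -/
def boxes (n : ℕ) : StableSkein := jw 0 n * jw n n

theorem boxes_comm (n : ℕ) : jw 0 n * jw n n = jw n n * jw 0 n := by
  have := jw_mul_jw_far 0 n 0 n
  simpa only [zero_add, add_zero] using this

theorem boxes_mul_boxes (n : ℕ) : boxes n * boxes n = boxes n := by
  rw [boxes, mul_assoc, ← mul_assoc (jw n n), ← boxes_comm, mul_assoc, jw_mul_jw, ← mul_assoc,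
    jw_mul_jw]

theorem U_mul_boxes (n : ℕ) : U n * (jw 0 n * jw (n + 2) n) = boxes n * U n := by
  have h1 := U_mul_jw 0 n 0
  have h2 := U_mul_jw_right n 0 n
  simp only [zero_add, add_zero] at h1 h2
  rw [mul_mul_of_mul_eq h1, mul_assoc, h2, ← mul_assoc, boxes]

theorem C_mul_boxes (n : ℕ) : (jw 0 n * jw (n + 2) n) * C n = C n * boxes n := by
  have h1 := C_mul_jw 0 n 0
  have h2 := C_mul_jw_right n 0 n
  simp only [zero_add, add_zero] at h1 h2
  rw [mul_assoc, ← h2, boxes, mul_mul_of_mul_eq h1, mul_assoc]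

theorem boxes_absorb (n : ℕ) : boxes (n + 1) * (jw 0 n * jw (n + 2) n) = boxes (n + 1) := by
  have h1 : jw 0 (n + 1) * jw 0 n = jw 0 (n + 1) := jw_mul_jw_of_le (l := 0) (by omega)
  have h2 : jw (n + 1) (n + 1) * jw (n + 2) n = jw (n + 1) (n + 1) :=
    jw_mul_jw_of_le (l := 1) (by omega)
  rw [boxes, boxes_comm, mul_assoc, mul_mul_of_mul_eq h1, ← mul_assoc, ← boxes_comm, mul_assoc, h2]

theorem boxes_absorb' (n : ℕ) : (jw 0 n * jw (n + 2) n) * boxes (n + 1) = boxes (n + 1) := by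
  have h1 : jw 0 n * jw 0 (n + 1) = jw 0 (n + 1) := jw_mul_jw_of_le' (l := 0) (by omega)
  have h2 : jw (n + 2) n * jw (n + 1) (n + 1) = jw (n + 1) (n + 1) :=
    jw_mul_jw_of_le' (k := n + 1) (l := 1) (by omega)
  rw [boxes, boxes_comm, mul_assoc, mul_mul_of_mul_eq h2, ← boxes_comm, mul_mul_of_mul_eq h1]

/-- Joining the last strand of the left projector to the first strand of the right one, at the
bottom and at the top. For `n = 0` the coefficient of the last term, which contains the meaningless
position `n - 1`, vanishes. -/
theorem middle_closure (n : ℕ) : U n * boxes (n + 1) * C n =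
    (δ - 2 * ratio n) • boxes n +
      ratio n ^ 2 • (boxes n * (C (n - 1) * U (n - 1)) * boxes n) := by
  cases n with
  | zero =>
    simp only [boxes, zero_add, jw_one, jw_zero, mul_one, U_mul_C, ratio]
    simp
  | succ n =>
    set r := ratio (n + 1) with hr
    set F := jw 0 (n + 1) with hF
    set G := jw (n + 3) (n + 1) with hG
    -- Wenzl's recursion, with the new strand in the middle for both projectors
    have hB : boxes (n + 2) = (F - r • (F * (C n * U n) * F)) *
        (G - r • (G * (C (n + 2) * U (n + 2)) * G)) := by
      rw [boxes, jw_add_two, jw_succ_left (n + 1) (n + 2), zero_add]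
    have hFG : F * G = G * F := by
      have := jw_mul_jw_far 0 (n + 1) 2 (n + 1)
      rwa [zero_add] at this
    have hFC : C (n + 2) * F = F * C (n + 2) := by
      have := C_mul_jw 0 (n + 1) 1
      rwa [zero_add] at this
    have hFU : U (n + 2) * F = F * U (n + 2) := by
      have := U_mul_jw 0 (n + 1) 1
      rwa [zero_add] at this
    have hU : U (n + 1) * (F * G) = boxes (n + 1) * U (n + 1) := U_mul_boxes (n + 1)
    have hC : F * G * C (n + 1) = C (n + 1) * boxes (n + 1) := C_mul_boxes (n + 1)
    have s1 : U (n + 1) * C n = 1 := U_succ_mul_C n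
    have s2 : U n * C (n + 1) = 1 := U_mul_C_succ n
    have s3 : U (n + 1) * C (n + 2) = 1 := U_mul_C_succ (n + 1)
    have s4 : U (n + 2) * C (n + 1) = 1 := U_succ_mul_C (n + 1)
    have s5 : U n * C (n + 2) = C n * U n := U_mul_C_far n 0
    have s6 : U n * U (n + 2) = U n * U n := U_mul_U n 0
    have hGC : G * C n = C n * jw (n + 1) (n + 1) := by
      have := C_mul_jw_right n 1 (n + 1)
      exact this.symm
    have hGU : U n * G = jw (n + 1) (n + 1) * U n := U_mul_jw_right n 1 (n + 1)
    have hFF : F * F = F := jw_mul_jw _ _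
    have hGG : G * G = G := jw_mul_jw _ _
    have hE : ∀ x : StableSkein, C n * (U n * (G * x)) = G * (C n * (U n * x)) := by
      intro x
      rw [mul_mul_of_mul_eq hGU, mul_assoc, mul_mul_of_mul_eq hGC.symm, mul_assoc]
    -- each of the four terms has the common form `FG … FG`
    have hbb := boxes_mul_boxes (n + 1)
    have t1 : U (n + 1) * (F * G) * C (n + 1) = δ • boxes (n + 1) := by
      rw [hU, mul_assoc, U_mul_C, mul_smul_comm, mul_one]
    have t2 : U (n + 1) * (F * (C n * U n) * F * G) * C (n + 1) = boxes (n + 1) := by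
      have e : F * (C n * U n) * F * G = F * G * ((C n * U n) * (F * G)) := by
        simp only [mul_assoc]
        rw [hFG, hE, ← mul_assoc G G, hGG]
      rw [e, ← mul_assoc, hU, mul_assoc, mul_assoc, mul_assoc, mul_assoc, hC,
        mul_mul_of_mul_eq s1, one_mul, mul_mul_of_mul_eq s2, one_mul, hbb]
    have t3 : U (n + 1) * (F * (G * (C (n + 2) * U (n + 2)) * G)) * C (n + 1) =
        boxes (n + 1) := by
      have e : F * (G * (C (n + 2) * U (n + 2)) * G) =
          F * G * ((C (n + 2) * U (n + 2)) * (F * G)) := by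
        simp only [mul_assoc]
        rw [mul_mul_of_mul_eq hFU, mul_assoc, mul_mul_of_mul_eq hFC, mul_assoc,
          mul_mul_of_mul_eq hFG.symm, mul_assoc, mul_mul_of_mul_eq hFF]
      rw [e, ← mul_assoc, hU, mul_assoc, mul_assoc, mul_assoc, mul_assoc, hC,
        mul_mul_of_mul_eq s3, one_mul, mul_mul_of_mul_eq s4, one_mul, hbb]
    have t4 : U (n + 1) * (F * (C n * U n) * F * (G * (C (n + 2) * U (n + 2)) * G)) * C (n + 1) =
        boxes (n + 1) * (C n * U n) * boxes (n + 1) := by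
      have e : F * (C n * U n) * F * (G * (C (n + 2) * U (n + 2)) * G) =
          F * G * ((C n * U n) * ((C (n + 2) * U (n + 2)) * (F * G))) := by
        simp only [mul_assoc]
        rw [mul_mul_of_mul_eq hFG, mul_assoc, hE, mul_mul_of_mul_eq hFU, mul_assoc,
          mul_mul_of_mul_eq hFC, mul_assoc]
      rw [e, ← mul_assoc, hU]
      simp only [mul_assoc] at hC ⊢
      rw [hC, mul_mul_of_mul_eq s1, one_mul, mul_mul_of_mul_eq s5, mul_assoc,
        mul_mul_of_mul_eq s6, mul_assoc, mul_mul_of_mul_eq s2, one_mul]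
    rw [hB]
    have expand : ∀ a b c d : StableSkein, U (n + 1) * ((a - r • b) * (c - r • d)) * C (n + 1) =
        U (n + 1) * (a * c) * C (n + 1) - r • (U (n + 1) * (b * c) * C (n + 1)) -
          r • (U (n + 1) * (a * d) * C (n + 1)) +
          r ^ 2 • (U (n + 1) * (b * d) * C (n + 1)) := by
      intro a b c d
      simp only [sub_mul, mul_sub, smul_mul_assoc, mul_smul_comm, pow_two, smul_smul, smul_sub]
      abel
    rw [expand, t1, t2, t3, t4, Nat.add_sub_cancel, sub_smul, two_mul, add_smul]
    abel

/-- The factor by which removing the innermost of `k` nested arcs between two projectors of size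
`i + k` multiplies a vertex of type `(i + k, i + k, 2i)`. -/
def arcFactor (i : ℕ) : ℕ → QA
  | 0 => 0
  | k + 1 => δ - 2 * ratio (i + k) + ratio (i + k) ^ 2 * arcFactor i k

theorem arcFactor_eq (i k : ℕ) :
    arcFactor i k = -(qInt (2 * i + k + 1) * qInt k) / qInt (i + k) ^ 2 := by
  induction k with
  | zero => simp [arcFactor, qInt_zero]
  | succ k ih =>
    have hA := A_ne_zero
    have h1 := qInt_ne_zero (i + k).succ_ne_zero
    rw [arcFactor, ih, ratio_eq]
    rcases Nat.eq_zero_or_pos (i + k) with h | h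
    · obtain ⟨rfl, rfl⟩ : i = 0 ∧ k = 0 := by omega
      have h2 := qInt_ne_zero one_ne_zero
      have h3 := qInt_add_two 0
      simp only [zero_add, mul_zero, qInt_zero, sub_zero] at h3 ⊢
      rw [h3]
      field_simp
      ring
    · have h2 := qInt_ne_zero (n := i + k) (by omega)
      have key : δ * qInt (i + k + 1) ^ 2 + 2 * qInt (i + k) * qInt (i + k + 1) -
          qInt (2 * i + k + 1) * qInt k = -(qInt (2 * i + k + 2) * qInt (k + 1)) := by
        simp only [qInt, δ, inv_pow, two_mul, pow_add]
        field_simp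
        ring
      have e : 2 * i + (k + 1) + 1 = 2 * i + k + 2 := by omega
      rw [e, ← add_assoc i k 1, ← key]
      field_simp
      ring

theorem arcFactor_ne_zero (i k : ℕ) : arcFactor i (k + 1) ≠ 0 := by
  rw [arcFactor_eq]
  exact div_ne_zero (neg_ne_zero.2 (mul_ne_zero (qInt_ne_zero (Nat.succ_ne_zero _))
    (qInt_ne_zero k.succ_ne_zero))) (pow_ne_zero _ (qInt_ne_zero (by omega)))

/-- `k` nested local minima, the outermost with `i` strands on its left. -/
def nestedCups (i k : ℕ) : StableSkein := W ((List.range' i k).map cup)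

/-- `k` nested local maxima, the outermost with `i` strands on its left. -/
def nestedCaps (i k : ℕ) : StableSkein := W ((List.range' i k).map cap).reverse

theorem nestedCups_succ (i k : ℕ) : nestedCups i (k + 1) = nestedCups i k * U (i + k) := by
  rw [nestedCups, List.range'_concat, List.map_append, W_append, one_mul]
  rfl

theorem nestedCaps_succ (i k : ℕ) : nestedCaps i (k + 1) = C (i + k) * nestedCaps i k := by
  rw [nestedCaps, List.range'_concat, List.map_append, List.reverse_append, W_append, one_mul]
  rfl

/-- The vertex of type `(i + k, i + k, 2i)`. -/
def vertex (i k : ℕ) : StableSkein := jw 0 (i + i) * nestedCups i k * boxes (i + k)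

theorem vertex_zero (i : ℕ) : vertex i 0 = jw 0 (i + i) := by
  have h1 : jw 0 (i + i) * jw 0 i = jw 0 (i + i) := jw_mul_jw_of_le (l := 0) (by omega)
  have h2 : jw 0 (i + i) * jw i i = jw 0 (i + i) := by
    have := jw_mul_jw_of_le (k := 0) (n := i + i) (l := i) (m := i) le_rfl
    rwa [zero_add] at this
  rw [vertex, nestedCups, List.range'_zero, List.map_nil, W_nil, mul_one, add_zero, boxes,
    ← mul_assoc, h1, h2]

theorem vertex_succ (i k : ℕ) :
    vertex i (k + 1) = vertex i k * U (i + k) * boxes (i + k + 1) := by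
  rw [vertex, vertex, nestedCups_succ, mul_assoc _ (boxes _) (U _), ← U_mul_boxes]
  simp only [mul_assoc]
  rw [← mul_assoc (jw 0 (i + k)) (jw (i + k + 2) (i + k)), boxes_absorb']
  rfl

/-- Closing the innermost arc of a vertex with `k + 1` arcs gives a multiple of the vertex with `k`
arcs, by `middle_closure` and induction. -/
theorem vertex_succ_mul_C (i k : ℕ) :
    vertex i (k + 1) * C (i + k) = arcFactor i (k + 1) • vertex i k := by
  have hb : ∀ k, vertex i k * boxes (i + k) = vertex i k := fun k => by
    rw [vertex, mul_assoc, boxes_mul_boxes]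
  have h0 : ∀ k, vertex i (k + 1) * C (i + k) = (δ - 2 * ratio (i + k)) • vertex i k +
      ratio (i + k) ^ 2 •
        (vertex i k * C (i + k - 1) * U (i + k - 1) * boxes (i + k)) := fun k => by
    rw [vertex_succ, mul_assoc, mul_assoc, ← mul_assoc (U _), middle_closure, mul_add,
      mul_smul_comm, mul_smul_comm, hb, ← mul_assoc, ← mul_assoc, ← mul_assoc, hb]
  induction k with
  | zero =>
    rw [h0, arcFactor, arcFactor, mul_zero, add_zero, add_zero, vertex_zero]
    cases i with
    | zero => simp [ratio]
    | succ i =>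
      have : jw 0 (i + 1 + (i + 1)) * C i = 0 := by
        have := jw_mul_C (k := 0) (n := i + 1 + (i + 1)) (i := i) (by omega)
        rwa [zero_add] at this
      rw [Nat.add_sub_cancel, this, zero_mul, zero_mul, smul_zero, add_zero]
  | succ k ih =>
    have e : i + (k + 1) - 1 = i + k := by omega
    rw [h0, e, ih, smul_mul_assoc, smul_mul_assoc, ← add_assoc i k 1, ← vertex_succ,
      ← mul_smul, ← add_smul]
    rfl

/-- The value of a vertex closed with its mirror image, as a multiple of the projector. -/
theorem vertex_mul_nestedCaps (i k : ℕ) :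
    vertex i k * nestedCaps i k =
      (∏ l ∈ Finset.range k, arcFactor i (l + 1)) • jw 0 (i + i) := by
  induction k with
  | zero =>
    rw [vertex_zero, nestedCaps, List.range'_zero, List.map_nil, List.reverse_nil, W_nil, mul_one,
      Finset.prod_range_zero, one_smul]
  | succ k ih =>
    rw [nestedCaps_succ, ← mul_assoc, vertex_succ_mul_C, smul_mul_assoc, ih, smul_smul,
      Finset.prod_range_succ, mul_comm]

/-- The plane closure of a projector. -/
theorem nestedCups_mul_jw_mul_nestedCaps (m : ℕ) :
    nestedCups 0 m * jw 0 m * nestedCaps 0 m = Δ m • 1 := by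
  induction m with
  | zero => simp [nestedCups, nestedCaps, W_nil, jw_zero, Δ_zero]
  | succ m ih =>
    have hp := partial_closure 0 m
    rw [zero_add] at hp
    rw [nestedCups_succ, nestedCaps_succ, zero_add, mul_assoc, mul_assoc, ← mul_assoc (jw _ _),
      ← mul_assoc (U m), ← mul_assoc (U m), hp, smul_mul_assoc, mul_smul_comm, ← mul_assoc, ih,
      smul_smul, div_mul_cancel₀ _ (Δ_ne_zero m)]


/-! ### The tensor representation -/

/-- Functions on the states of infinitely many strands, each state assigning a basis vector of a
two-dimensional space to every strand. -/
abbrev StateSpace : Type := Stream' Bool → QA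

/-- Operators on the functions of states. A word of slices acts by pulling functions back from the
top of the diagram to its bottom, which is multiplicative for stacking with the lower factor on the
left. -/
abbrev Operator : Type := Module.End QA StateSpace

/-- Adding one strand on the left of an operator, as an algebra endomorphism. -/
def shiftOperator : Operator →ₐ[QA] Operator :=
  AlgHom.ofLinearMap
    { toFun := fun F =>
        { toFun := fun φ s => F (fun u => φ (Stream'.cons s.head u)) s.tail
          map_add' := fun φ ψ => by
            funext s
            exact congrFun (F.map_add (fun u => φ (Stream'.cons s.head u))
              (fun u => ψ (Stream'.cons s.head u))) s.tail
          map_smul' := fun c φ => by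
            funext s
            exact congrFun (F.map_smul c (fun u => φ (Stream'.cons s.head u))) s.tail }
      map_add' := fun _ _ => rfl
      map_smul' := fun _ _ => rfl }
    (by
      refine LinearMap.ext fun φ => funext fun s => ?_
      change φ (Stream'.cons s.head s.tail) = φ s
      rw [Stream'.eta])
    (fun _ _ => rfl)

theorem shiftOperator_apply (F : Operator) (φ : StateSpace) (s : Stream' Bool) :
    shiftOperator F φ s = F (fun u => φ (Stream'.cons s.head u)) s.tail := rfl

/-- The operator of a local minimum without strands on its left. -/
def cupOperator : Operator where
  toFun φ s := φ (Stream'.cons true (Stream'.cons false s)) +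
    -A⁻¹ ^ 2 * φ (Stream'.cons false (Stream'.cons true s))
  map_add' φ ψ := by
    funext s
    simp only [Pi.add_apply]
    ring
  map_smul' c φ := by
    funext s
    simp only [Pi.smul_apply, smul_eq_mul, RingHom.id_apply]
    ring

/-- The bilinear form of a local maximum. It is inverse to the tensor of a local minimum; with
this normalization no square root of `-1` is needed for a circle to have the value `δ`. -/
def capForm : Bool → Bool → QA
  | true, false => -A ^ 2
  | false, true => 1
  | _, _ => 0

/-- The operator of a local maximum without strands on its left. -/
def capOperator : Operator where
  toFun φ s := capForm s.head s.tail.head * φ s.tail.tail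
  map_add' φ ψ := by
    funext s
    simp only [Pi.add_apply]
    ring
  map_smul' c φ := by
    funext s
    simp only [Pi.smul_apply, smul_eq_mul, RingHom.id_apply]
    ring

theorem cupOperator_apply (φ : StateSpace) (s : Stream' Bool) :
    cupOperator φ s = φ (Stream'.cons true (Stream'.cons false s)) +
      -A⁻¹ ^ 2 * φ (Stream'.cons false (Stream'.cons true s)) := rfl

theorem capOperator_apply (φ : StateSpace) (s : Stream' Bool) :
    capOperator φ s = capForm s.head s.tail.head * φ s.tail.tail := rfl

theorem cupOperator_mul_capOperator : cupOperator * capOperator = δ • 1 := by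
  refine LinearMap.ext fun φ => funext fun s => ?_
  simp only [Module.End.mul_apply, cupOperator_apply, capOperator_apply, Stream'.head_cons,
    Stream'.tail_cons, capForm, LinearMap.smul_apply, Module.End.one_apply, Pi.smul_apply,
    smul_eq_mul, δ]
  ring

theorem cupOperator_mul_shift_capOperator : cupOperator * shiftOperator capOperator = 1 := by
  have hA := A_ne_zero
  refine LinearMap.ext fun φ => funext fun s => ?_
  rw [← Stream'.eta s]
  generalize s.head = b
  generalize s.tail = u
  cases b <;> simp [cupOperator_apply, shiftOperator_apply, capOperator_apply, capForm, hA]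

theorem shift_cupOperator_mul_capOperator : shiftOperator cupOperator * capOperator = 1 := by
  have hA := A_ne_zero
  refine LinearMap.ext fun φ => funext fun s => ?_
  rw [← Stream'.eta s]
  generalize s.head = b
  generalize s.tail = u
  cases b <;> simp [cupOperator_apply, shiftOperator_apply, capOperator_apply, capForm, hA]

theorem cupOperator_mul_shift (F : Operator) :
    cupOperator * shiftOperator (shiftOperator F) = F * cupOperator := by
  refine LinearMap.ext fun φ => funext fun s => ?_
  have e : cupOperator φ = (fun s => φ (Stream'.cons true (Stream'.cons false s))) +
      (-A⁻¹ ^ 2 : QA) • fun s => φ (Stream'.cons false (Stream'.cons true s)) := rfl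
  rw [Module.End.mul_apply, Module.End.mul_apply, e, map_add, map_smul]
  rfl

theorem capOperator_mul (F : Operator) :
    capOperator * F = shiftOperator (shiftOperator F) * capOperator := by
  refine LinearMap.ext fun φ => funext fun s => ?_
  have e : (fun u => capOperator φ (Stream'.cons s.head (Stream'.cons s.tail.head u))) =
      capForm s.head s.tail.head • φ := rfl
  have e' : (shiftOperator (shiftOperator F) * capOperator) φ s =
      F (fun u => capOperator φ (Stream'.cons s.head (Stream'.cons s.tail.head u)))
        s.tail.tail := rfl
  rw [e', e, map_smul]
  rfl

/-- The operator of an elementary piece without strands on its left. -/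
def kindOperator : Kind → Operator
  | .cup => cupOperator
  | .cap => capOperator
  | .overX => A • 1 + A⁻¹ • (capOperator * cupOperator)
  | .underX => A⁻¹ • 1 + A • (capOperator * cupOperator)

/-- The operator of a slice. -/
def sliceOperator (s : Slice) : Operator := (shiftOperator ^ (s.pos)) (kindOperator s.kind)

/-- The operator of a word of slices. -/
def wordOperator (w : List Slice) : Operator := (w.map sliceOperator).prod

theorem wordOperator_append (u v : List Slice) :
    wordOperator (u ++ v) = wordOperator u * wordOperator v := by
  simp [wordOperator]

theorem wordOperator_map_shift (k : ℕ) (w : List Slice) :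
    wordOperator (w.map (Slice.shift k)) = (shiftOperator ^ k) (wordOperator w) := by
  induction w with
  | nil => exact (map_one (shiftOperator ^ k)).symm
  | cons s w ih =>
    have e : sliceOperator (s.shift k) = (shiftOperator ^ k) (sliceOperator s) :=
      congrArg (fun f : Operator →ₐ[QA] Operator => f (kindOperator s.kind)) (pow_add _ _ _)
    simp only [wordOperator, List.map_cons, List.prod_cons, map_mul] at ih ⊢
    rw [ih, e]

/-- An elementary piece and an operator acting on its right may exchange their heights. -/
theorem kindOperator_mul_shift (x : Kind) (d : ℕ) (F : Operator) :
    kindOperator x * (shiftOperator ^ (x.outs + d)) F =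
      (shiftOperator ^ (x.ins + d)) F * kindOperator x := by
  have h2 : ∀ F, (shiftOperator ^ (2 + d)) F =
      shiftOperator (shiftOperator ((shiftOperator ^ d) F)) :=
    fun F => congrArg (fun f : Operator →ₐ[QA] Operator => f F) (pow_add _ 2 d)
  have hcup : ∀ F, cupOperator * (shiftOperator ^ (2 + d)) F =
      (shiftOperator ^ d) F * cupOperator :=
    fun F => by rw [h2, cupOperator_mul_shift]
  have hcap : ∀ F, capOperator * (shiftOperator ^ d) F =
      (shiftOperator ^ (2 + d)) F * capOperator :=
    fun F => by rw [h2, capOperator_mul]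
  have he : capOperator * cupOperator * (shiftOperator ^ (2 + d)) F =
      (shiftOperator ^ (2 + d)) F * (capOperator * cupOperator) := by
    rw [mul_assoc, hcup, ← mul_assoc, hcap, mul_assoc]
  cases x with
  | cup =>
    simp only [kindOperator, Kind.ins, Kind.outs, zero_add]
    exact hcup F
  | cap =>
    simp only [kindOperator, Kind.ins, Kind.outs, zero_add]
    exact hcap F
  | overX =>
    simp only [kindOperator, Kind.ins, Kind.outs, add_mul, mul_add, smul_mul_assoc, mul_smul_comm,
      one_mul, mul_one, he]
  | underX =>
    simp only [kindOperator, Kind.ins, Kind.outs, add_mul, mul_add, smul_mul_assoc, mul_smul_comm,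
      one_mul, mul_one, he]

/-- The Temperley-Lieb relations imply the third Reidemeister move. -/
theorem braid_relation {K R : Type*} [Field K] [Ring R] [Algebra K R] {q : K} (hq : q ≠ 0) {a b : R}
    (ha : a * a = (-q ^ 2 - q⁻¹ ^ 2) • a) (hb : b * b = (-q ^ 2 - q⁻¹ ^ 2) • b)
    (hab : a * b * a = a) (hba : b * a * b = b) :
    (q • 1 + q⁻¹ • a) * ((q • 1 + q⁻¹ • b) * (q • 1 + q⁻¹ • a)) =
      (q • 1 + q⁻¹ • b) * ((q • 1 + q⁻¹ • a) * (q • 1 + q⁻¹ • b)) := by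
  rw [mul_assoc] at hab hba
  simp only [add_mul, mul_add, smul_mul_assoc, mul_smul_comm, one_mul, mul_one, smul_add,
    smul_smul, ha, hb, hab, hba]
  match_scalars <;> field_simp <;> ring

/-- The Temperley-Lieb relations imply the second Reidemeister move. -/
theorem inverse_relation {K R : Type*} [Field K] [Ring R] [Algebra K R] {q : K} (hq : q ≠ 0) {a : R}
    (ha : a * a = (-q ^ 2 - q⁻¹ ^ 2) • a) :
    (q • 1 + q⁻¹ • a) * (q⁻¹ • 1 + q • a) = 1 ∧ (q⁻¹ • 1 + q • a) * (q • 1 + q⁻¹ • a) = 1 := by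
  simp only [add_mul, mul_add, smul_mul_assoc, mul_smul_comm, one_mul, mul_one, smul_add,
    smul_smul, ha]
  constructor <;> match_scalars <;> field_simp <;> ring

/-- The operators of words are invariant under isotopy. -/
theorem wordOperator_move {l r : List Slice} (h : Move l r) : wordOperator l = wordOperator r := by
  have hA := A_ne_zero
  -- all moves but the exchange of heights follow from those at the far left
  have key : ∀ (i : ℕ) (l r : List Slice), wordOperator l = wordOperator r →
      wordOperator (l.map (Slice.shift i)) = wordOperator (r.map (Slice.shift i)) := by
    intro i l r h
    rw [wordOperator_map_shift, wordOperator_map_shift, h]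
  have huc := cupOperator_mul_capOperator
  have huc' : shiftOperator cupOperator * shiftOperator capOperator = δ • 1 := by
    rw [← map_mul, huc, map_smul, map_one]
  have h1 := cupOperator_mul_shift_capOperator
  have h2 := shift_cupOperator_mul_capOperator
  have e0 : capOperator * cupOperator * (capOperator * cupOperator) =
      δ • (capOperator * cupOperator) := by
    rw [mul_assoc, mul_mul_of_mul_eq huc, smul_mul_assoc, one_mul, mul_smul_comm]
  cases h with
  | exchange x y i d =>
    have := congrArg ((shiftOperator ^ i)) (kindOperator_mul_shift x d (kindOperator y))
    simp only [map_mul, ← AlgHom.mul_apply, ← pow_add] at this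
    simpa [wordOperator, sliceOperator, add_assoc] using this
  | snake_left i =>
    refine key i [cup 0, cap 1] [] ?_
    simpa [wordOperator, sliceOperator, cup, cap, kindOperator] using h1
  | snake_right i =>
    refine key i [cup 1, cap 0] [] ?_
    simpa [wordOperator, sliceOperator, cup, cap, kindOperator] using h2
  | cup_over i =>
    refine key i [cup 0, overX 1] [cup 1, underX 0] ?_
    simp only [wordOperator, sliceOperator, cup, overX, underX, kindOperator, List.map_cons,
      List.map_nil, List.prod_cons, List.prod_nil, pow_zero, AlgHom.one_apply,
      pow_one, map_add, map_smul, map_mul, map_one, mul_add, mul_smul_comm, mul_one,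
      ← mul_assoc, h1, h2, one_mul]
    exact add_comm _ _
  | cup_under i =>
    refine key i [cup 0, underX 1] [cup 1, overX 0] ?_
    simp only [wordOperator, sliceOperator, cup, overX, underX, kindOperator, List.map_cons,
      List.map_nil, List.prod_cons, List.prod_nil, pow_zero, AlgHom.one_apply,
      pow_one, map_add, map_smul, map_mul, map_one, mul_add, mul_smul_comm, mul_one,
      ← mul_assoc, h1, h2, one_mul]
    exact add_comm _ _
  | over_cap i =>
    refine key i [overX 1, cap 0] [underX 0, cap 1] ?_
    simp only [wordOperator, sliceOperator, cap, overX, underX, kindOperator, List.map_cons,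
      List.map_nil, List.prod_cons, List.prod_nil, pow_zero, AlgHom.one_apply,
      pow_one, map_add, map_smul, map_mul, map_one, add_mul, smul_mul_assoc, mul_one,
      mul_assoc, h1, h2, one_mul]
    exact add_comm _ _
  | under_cap i =>
    refine key i [underX 1, cap 0] [overX 0, cap 1] ?_
    simp only [wordOperator, sliceOperator, cap, overX, underX, kindOperator, List.map_cons,
      List.map_nil, List.prod_cons, List.prod_nil, pow_zero, AlgHom.one_apply,
      pow_one, map_add, map_smul, map_mul, map_one, add_mul, smul_mul_assoc, mul_one,
      mul_assoc, h1, h2, one_mul]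
    exact add_comm _ _
  | curl i =>
    refine key i [cup 1, overX 0, cap 1] [cup 0, overX 1, cap 0] ?_
    simp only [wordOperator, sliceOperator, cup, cap, overX, kindOperator, List.map_cons,
      List.map_nil, List.prod_cons, List.prod_nil, pow_zero, AlgHom.one_apply,
      pow_one, map_add, map_smul, map_mul, map_one, add_mul, mul_add, smul_mul_assoc,
      mul_smul_comm, mul_one, mul_assoc, h1, h2, one_mul, huc, huc']
  | over_under i =>
    refine key i [overX 0, underX 0] [] ?_
    simp only [wordOperator, sliceOperator, overX, underX, kindOperator, List.map_cons,
      List.map_nil, List.prod_cons, List.prod_nil, pow_zero, AlgHom.one_apply, mul_one]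
    exact (inverse_relation hA e0).1
  | under_over i =>
    refine key i [underX 0, overX 0] [] ?_
    simp only [wordOperator, sliceOperator, overX, underX, kindOperator, List.map_cons,
      List.map_nil, List.prod_cons, List.prod_nil, pow_zero, AlgHom.one_apply, mul_one]
    exact (inverse_relation hA e0).2
  | braid i =>
    refine key i [overX 0, overX 1, overX 0] [overX 1, overX 0, overX 1] ?_
    simp only [wordOperator, sliceOperator, overX, kindOperator, List.map_cons, List.map_nil,
      List.prod_cons, List.prod_nil, pow_zero, AlgHom.one_apply, pow_one, map_add,
      map_smul, map_mul, map_one, mul_one]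
    refine braid_relation hA e0 ?_ ?_ ?_
    · rw [mul_assoc, mul_mul_of_mul_eq huc', smul_mul_assoc, one_mul, mul_smul_comm, δ]
    · rw [mul_assoc, mul_assoc, mul_assoc, mul_mul_of_mul_eq h1, one_mul, mul_mul_of_mul_eq h2,
        one_mul]
    · rw [mul_assoc, mul_assoc, mul_assoc, mul_mul_of_mul_eq h2, one_mul, mul_mul_of_mul_eq h1,
        one_mul]

/-! ### Weighted traces -/

/-- The states of `k` strands. -/
def words : ℕ → Finset (List Bool)
  | 0 => {[]}
  | k + 1 => (words k).image (List.cons true) ∪ (words k).image (List.cons false)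

theorem mem_words {k : ℕ} {l : List Bool} : l ∈ words k ↔ l.length = k := by
  induction k generalizing l with
  | zero => simp [words]
  | succ k ih =>
    cases l with
    | nil => simp [words]
    | cons b l => cases b <;> simp [words, ih]

theorem sum_words_succ {M : Type*} [AddCommMonoid M] (k : ℕ) (g : List Bool → M) :
    ∑ l ∈ words (k + 1), g l = ∑ l ∈ words k, g (true :: l) + ∑ l ∈ words k, g (false :: l) := by
  rw [words, Finset.sum_union, Finset.sum_image (by simp), Finset.sum_image (by simp)]
  rw [Finset.disjoint_left]
  simp

/-- The state of infinitely many strands that extends a state of finitely many ones by a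
constant. -/
def pad : List Bool → Stream' Bool
  | [] => Stream'.const false
  | b :: l => Stream'.cons b (pad l)

theorem pad_injOn {l l' : List Bool} (h : l.length = l'.length) (e : pad l = pad l') : l = l' := by
  induction l generalizing l' with
  | nil => exact (List.length_eq_zero_iff.1 h.symm).symm
  | cons b l ih =>
    cases l' with
    | nil => cases h
    | cons b' l' =>
      have h1 : b = b' := congrArg Stream'.head e
      have h2 : pad l = pad l' := congrArg Stream'.tail e
      rw [h1, ih (Nat.succ.inj h) h2]

/-- The weight of a state: the product of `t` for every strand in state `true` and `t⁻¹` for every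
strand in state `false`. -/
def weight (t : QA) : List Bool → QA
  | [] => 1
  | true :: l => t * weight t l
  | false :: l => t⁻¹ * weight t l

/-- `F` restricts to a map between the states of `m` and of `n` strands, with matrix `a`, that
preserves weights. -/
def HasMatrix (t : QA) (m n : ℕ) (F : Operator) (a : List Bool → List Bool → QA) : Prop :=
  (∀ l ∈ words m, ∀ φ : StateSpace, F φ (pad l) = ∑ l' ∈ words n, a l l' * φ (pad l')) ∧
    ∀ l ∈ words m, ∀ l' ∈ words n, a l l' ≠ 0 → weight t l = weight t l'

section
variable {t : QA} {m n k : ℕ} {F G : Operator} {a b : List Bool → List Bool → QA}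

theorem HasMatrix.mul (hF : HasMatrix t m n F a) (hG : HasMatrix t n k G b) :
    HasMatrix t m k (F * G) fun l l' => ∑ l'' ∈ words n, a l l'' * b l'' l' := by
  refine ⟨fun l hl φ => ?_, fun l hl l' hl' h => ?_⟩
  · rw [Module.End.mul_apply, hF.1 l hl]
    simp only [Finset.sum_mul]
    rw [Finset.sum_comm]
    refine Finset.sum_congr rfl fun l'' hl'' => ?_
    rw [hG.1 l'' hl'', Finset.mul_sum]
    exact Finset.sum_congr rfl fun _ _ => (mul_assoc _ _ _).symm
  · obtain ⟨l'', hl'', h⟩ := Finset.exists_ne_zero_of_sum_ne_zero h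
    exact (hF.2 l hl l'' hl'' (left_ne_zero_of_mul h)).trans
      (hG.2 l'' hl'' l' hl' (right_ne_zero_of_mul h))

theorem HasMatrix.add (hF : HasMatrix t m n F a) (hG : HasMatrix t m n G b) :
    HasMatrix t m n (F + G) fun l l' => a l l' + b l l' := by
  refine ⟨fun l hl φ => ?_, fun l hl l' hl' h => ?_⟩
  · simp only [LinearMap.add_apply, Pi.add_apply, hF.1 l hl, hG.1 l hl, add_mul,
      Finset.sum_add_distrib]
  · by_cases h1 : a l l' = 0
    · simp only [h1, zero_add] at h
      exact hG.2 l hl l' hl' h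
    · exact hF.2 l hl l' hl' h1

theorem HasMatrix.smul (c : QA) (hF : HasMatrix t m n F a) :
    HasMatrix t m n (c • F) fun l l' => c * a l l' := by
  refine ⟨fun l hl φ => ?_, fun l hl l' hl' h => hF.2 l hl l' hl' (right_ne_zero_of_mul h)⟩
  simp only [LinearMap.smul_apply, Pi.smul_apply, smul_eq_mul, hF.1 l hl, Finset.mul_sum,
    mul_assoc]

theorem hasMatrix_one (t : QA) (m : ℕ) :
    HasMatrix t m m 1 fun l l' => if l' = l then 1 else 0 := by
  refine ⟨fun l hl φ => ?_, fun l hl l' hl' h => ?_⟩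
  · simp [hl]
  · rw [(ite_ne_right_iff.1 h).1]

theorem hasMatrix_cup (ht : t ≠ 0) (m : ℕ) : HasMatrix t m (m + 2) cupOperator fun l l' =>
    (if l' = true :: false :: l then 1 else 0) +
      -A⁻¹ ^ 2 * if l' = false :: true :: l then 1 else 0 := by
  refine ⟨fun l hl φ => ?_, fun l hl l' hl' h => ?_⟩
  · have h1 : true :: false :: l ∈ words (m + 2) := by
      rw [mem_words] at hl ⊢
      simp [hl]
    have h2 : false :: true :: l ∈ words (m + 2) := by
      rw [mem_words] at hl ⊢
      simp [hl]
    simp only [add_mul, Finset.sum_add_distrib, mul_assoc, ← Finset.mul_sum, ite_mul, one_mul,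
      zero_mul, Finset.sum_ite_eq', h1, h2, if_true]
    rfl
  · by_cases h1 : l' = true :: false :: l
    · rw [h1, weight, weight, mul_inv_cancel_left₀ ht]
    · by_cases h2 : l' = false :: true :: l
      · rw [h2, weight, weight, inv_mul_cancel_left₀ ht]
      · simp [h1, h2] at h

theorem hasMatrix_cap (ht : t ≠ 0) (m : ℕ) : HasMatrix t (m + 2) m capOperator fun l l' =>
    capForm (pad l).head (pad l).tail.head * if l' = l.tail.tail then 1 else 0 := by
  have hl : ∀ l ∈ words (m + 2), ∃ x y l₀, l = x :: y :: l₀ ∧ l₀ ∈ words m := by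
    intro l hl
    rw [mem_words] at hl
    match l, hl with
    | x :: y :: l₀, hl => exact ⟨x, y, l₀, rfl, mem_words.2 (by simpa using hl)⟩
  refine ⟨fun l hl' φ => ?_, fun l hl' l' _ h => ?_⟩
  · obtain ⟨x, y, l₀, rfl, h0⟩ := hl l hl'
    rw [Finset.sum_eq_single l₀ (fun l' _ h => by simp [h]) (fun h => absurd h0 h)]
    simp only [List.tail_cons, if_true, mul_one]
    rfl
  · obtain ⟨x, y, l₀, rfl, h0⟩ := hl l hl'
    rw [(ite_ne_right_iff.1 (right_ne_zero_of_mul h)).1]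
    have h1 : capForm x y ≠ 0 := left_ne_zero_of_mul h
    cases x <;> cases y <;> simp_all [weight, capForm]

theorem HasMatrix.shift (hF : HasMatrix t m n F a) :
    HasMatrix t (m + 1) (n + 1) (shiftOperator F) fun l l' =>
      if l.head? = l'.head? then a l.tail l'.tail else 0 := by
  have hl : ∀ l ∈ words (m + 1), ∃ x l₀, l = x :: l₀ ∧ l₀ ∈ words m := by
    intro l hl
    rw [mem_words] at hl
    match l, hl with
    | x :: l₀, hl => exact ⟨x, l₀, rfl, mem_words.2 (by simpa using hl)⟩
  refine ⟨fun l hl1 φ => ?_, fun l hl1 l' hl1' h => ?_⟩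
  · obtain ⟨x, l₀, rfl, h0⟩ := hl l hl1
    have := hF.1 l₀ h0 fun u => φ (Stream'.cons x u)
    rw [sum_words_succ]
    cases x <;> simpa using! this
  · obtain ⟨h1, h2⟩ := ite_ne_right_iff.1 h
    obtain ⟨x, l₀, rfl, h0⟩ := hl l hl1
    rw [mem_words] at hl1'
    cases l' with
    | nil => cases hl1'
    | cons y l' =>
      simp only [List.head?_cons, Option.some.injEq] at h1
      subst h1
      have := hF.2 l₀ h0 l' (mem_words.2 (by simpa using hl1')) h2
      cases x <;> simp only [weight, this]

theorem exists_hasMatrix_kind (ht : t ≠ 0) (x : Kind) (d : ℕ) :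
    ∃ a, HasMatrix t (x.ins + d) (x.outs + d) (kindOperator x) a := by
  have he := (hasMatrix_cap ht d).mul (hasMatrix_cup ht d)
  cases x with
  | cup => simp only [Kind.ins, Kind.outs, zero_add, add_comm 2 d]; exact ⟨_, hasMatrix_cup ht d⟩
  | cap => simp only [Kind.ins, Kind.outs, zero_add, add_comm 2 d]; exact ⟨_, hasMatrix_cap ht d⟩
  | overX =>
    simp only [Kind.ins, Kind.outs, add_comm 2 d]
    exact ⟨_, ((hasMatrix_one t _).smul _).add (he.smul _)⟩
  | underX =>
    simp only [Kind.ins, Kind.outs, add_comm 2 d]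
    exact ⟨_, ((hasMatrix_one t _).smul _).add (he.smul _)⟩

theorem exists_hasMatrix_shift_pow (h : ∃ a, HasMatrix t m n F a) (i : ℕ) :
    ∃ a, HasMatrix t (m + i) (n + i) ((shiftOperator ^ i) F) a := by
  induction i with
  | zero => exact h
  | succ i ih =>
    obtain ⟨a, ha⟩ := ih
    rw [pow_succ', AlgHom.mul_apply]
    exact ⟨_, ha.shift⟩

theorem exists_hasMatrix (ht : t ≠ 0) {w : List Slice} :
    ∀ {m : ℕ}, IsDiagram m w n → ∃ a, HasMatrix t m n (wordOperator w) a := by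
  induction w with
  | nil => intro m h; cases h; exact ⟨_, hasMatrix_one t _⟩
  | cons s w ih =>
    intro m h
    obtain ⟨b, hb⟩ := ih h.2
    obtain ⟨a, ha⟩ := exists_hasMatrix_shift_pow
      (exists_hasMatrix_kind ht s.kind (m - s.pos - s.kind.ins)) s.pos
    have h1 := h.1
    have e1 : s.kind.ins + (m - s.pos - s.kind.ins) + s.pos = m := by omega
    have e2 : s.kind.outs + (m - s.pos - s.kind.ins) + s.pos = m - s.kind.ins + s.kind.outs := by
      omega
    rw [e1, e2] at ha
    exact ⟨_, ha.mul hb⟩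

end

open Classical in
/-- The weighted trace of an operator over the states of `k` strands. -/
def weightedTrace (t : QA) (k : ℕ) : Operator →ₗ[QA] QA where
  toFun F := ∑ l ∈ words k, weight t l * F (Pi.single (pad l) 1) (pad l)
  map_add' F G := by
    simp only [LinearMap.add_apply, Pi.add_apply, mul_add, Finset.sum_add_distrib]
  map_smul' c F := by
    simp only [LinearMap.smul_apply, Pi.smul_apply, smul_eq_mul, Finset.mul_sum, RingHom.id_apply,
      mul_left_comm]

open Classical in
theorem HasMatrix.weightedTrace_eq {t : QA} {k : ℕ} {F : Operator} {a : List Bool → List Bool → QA}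
    (h : HasMatrix t k k F a) : weightedTrace t k F = ∑ l ∈ words k, weight t l * a l l := by
  refine Finset.sum_congr rfl fun l hl => ?_
  rw [h.1 l hl, Finset.sum_eq_single l]
  · rw [Pi.single_eq_same, mul_one]
  · intro l' hl' hne
    rw [Pi.single_eq_of_ne, mul_zero]
    intro e
    exact hne (pad_injOn ((mem_words.1 hl').trans (mem_words.1 hl).symm) e)
  · intro h
    exact absurd hl h

/-- The weighted trace is invariant under rotation of the annulus, because diagrams preserve
weights. -/
theorem weightedTrace_comm {t : QA} (ht : t ≠ 0) {m n : ℕ} {u v : List Slice}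
    (hu : IsDiagram m u n) (hv : IsDiagram n v m) :
    weightedTrace t m (wordOperator (u ++ v)) = weightedTrace t n (wordOperator (v ++ u)) := by
  obtain ⟨a, ha⟩ := exists_hasMatrix ht hu
  obtain ⟨b, hb⟩ := exists_hasMatrix ht hv
  rw [wordOperator_append, wordOperator_append, (ha.mul hb).weightedTrace_eq,
    (hb.mul ha).weightedTrace_eq]
  simp only [Finset.mul_sum]
  rw [Finset.sum_comm]
  refine Finset.sum_congr rfl fun l hl => Finset.sum_congr rfl fun l' hl' => ?_
  by_cases h : a l' l = 0
  · rw [h, zero_mul, mul_zero, mul_zero, mul_zero]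
  · rw [ha.2 l' hl' l hl h, mul_comm (a l' l)]

theorem wordOperator_overX (i : ℕ) :
    wordOperator [overX i] = A • 1 + A⁻¹ • wordOperator [cap i, cup i] := by
  simp [wordOperator, sliceOperator, overX, cup, cap, kindOperator, -AlgHom.coe_pow]

theorem wordOperator_circle (i : ℕ) : wordOperator [cup i, cap i] = δ • 1 := by
  have h := congrArg (shiftOperator ^ i) cupOperator_mul_capOperator
  simpa [wordOperator, sliceOperator, cup, cap, kindOperator] using h

/-- The invariant of links in the solid torus given by weighted traces; it takes the value `t + t⁻¹`
on the core. -/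
def traceFunctional (t : QA) (ht : t ≠ 0) : AnnularSkein →ₗ[QA] QA :=
  annularRelations.liftQ
    (Finsupp.linearCombination QA (Quot.lift
      (fun D : AnnularDiagram => weightedTrace t D.1 (wordOperator D.2.1))
      (by
        rintro _ _ (⟨⟨u, v, l, r, h, h1, h2⟩⟩ | ⟨D, E⟩)
        · simp only [h1, h2, wordOperator_append, wordOperator_move h]
        · exact weightedTrace_comm ht D.2 E.2)))
    (by
      refine Submodule.span_le.2 ?_
      rintro x (⟨k, D, D₀, D₁, ⟨u, v, i, h, h0, h1⟩, rfl⟩ | ⟨k, D, D₀, ⟨u, v, i, h, h0⟩, rfl⟩)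
      · simp only [SetLike.mem_coe, LinearMap.mem_ker, map_sub, map_smul, link,
          Finsupp.linearCombination_single, one_smul, h, h0, h1, wordOperator_append,
          wordOperator_overX, mul_add, add_mul, mul_smul_comm, smul_mul_assoc, mul_one, map_add]
        abel
      · simp only [SetLike.mem_coe, LinearMap.mem_ker, map_add, map_smul, link,
          Finsupp.linearCombination_single, h, h0, wordOperator_append,
          wordOperator_circle, mul_smul_comm, smul_mul_assoc, mul_one, δ, smul_eq_mul]
        ring)

theorem traceFunctional_zPow (t : QA) (ht : t ≠ 0) (k : ℕ) :
    traceFunctional t ht (zPow k) = (t + t⁻¹) ^ k := by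
  have e : traceFunctional t ht (zPow k) = weightedTrace t k 1 := by
    refine (Submodule.liftQ_apply _ _ _).trans ?_
    simp [link, Diagram.id, wordOperator]
  rw [e, (hasMatrix_one t k).weightedTrace_eq]
  clear e
  simp only [if_true, mul_one]
  induction k with
  | zero => simp [words, weight]
  | succ k ih =>
    rw [sum_words_succ]
    simp only [weight, ← Finset.mul_sum, ih]
    ring


/-! ### Diagrams without crossings -/

theorem W_underX (i : ℕ) : W [underX i] = A⁻¹ • 1 + A • (W [cap i] * W [cup i]) := by
  have hA := A_ne_zero
  have he : W [cap i] * W [cup i] * (W [cap i] * W [cup i]) =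
      (-A ^ 2 - A⁻¹ ^ 2) • (W [cap i] * W [cup i]) := by
    rw [mul_assoc, mul_mul_of_mul_eq (W_circle i), smul_mul_assoc, one_mul, mul_smul_comm, δ]
  have h1 : W [underX i] * W [overX i] = 1 := by
    rw [← W_append, ← W_nil]
    exact W_move (Move.under_over i)
  rw [W_overX] at h1
  exact left_inv_eq_right_inv h1 (inverse_relation hA he).1

/-- The span of the diagrams that consist of local maxima followed by local minima. -/
def capCupSpan (m n : ℕ) : Submodule QA (Skein m n) :=
  Submodule.span QA {x | ∃ (j : ℕ) (D : Diagram m j) (E : Diagram j n),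
    (∀ s ∈ D.1, s.kind = .cap) ∧ (∀ s ∈ E.1, s.kind = .cup) ∧ x = comp (mk D) (mk E)}

theorem comp_assoc {m n k l : ℕ} (x : Skein m n) (y : Skein n k) (z : Skein k l) :
    comp (comp x y) z = comp x (comp y z) := by
  apply ι_injective
  simp only [ι_comp, mul_assoc]

theorem id_comp {m n : ℕ} (x : Skein m n) : comp (mk (Diagram.id m)) x = x := by
  apply ι_injective
  rw [ι_comp, ι_id, one_mul]

theorem comp_id {m n : ℕ} (x : Skein m n) : comp x (mk (Diagram.id n)) = x := by
  apply ι_injective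
  rw [ι_comp, ι_id, mul_one]

theorem comp_mem_capCupSpan_right {m n k : ℕ} {x : Skein m n} (hx : x ∈ capCupSpan m n)
    (E : Diagram n k) (hE : ∀ s ∈ E.1, s.kind = .cup) : comp x (mk E) ∈ capCupSpan m k := by
  induction hx using Submodule.span_induction with
  | mem x hx =>
    obtain ⟨j, D, E', hD, hE', rfl⟩ := hx
    refine Submodule.subset_span ⟨j, D, E'.comp E, hD, fun s hs => ?_, ?_⟩
    · rcases List.mem_append.1 hs with h | h
      exacts [hE' s h, hE s h]
    · rw [comp_assoc, comp_mk E' E]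
  | zero => simp
  | add x y _ _ hx hy => simpa using Submodule.add_mem _ hx hy
  | smul c x _ hx => simpa using Submodule.smul_mem _ c hx

theorem comp_mem_capCupSpan_left {m n k : ℕ} {x : Skein n k} (hx : x ∈ capCupSpan n k)
    (D : Diagram m n) (hD : ∀ s ∈ D.1, s.kind = .cap) : comp (mk D) x ∈ capCupSpan m k := by
  induction hx using Submodule.span_induction with
  | mem x hx =>
    obtain ⟨j, D', E, hD', hE, rfl⟩ := hx
    refine Submodule.subset_span ⟨j, D.comp D', E, fun s hs => ?_, hE, ?_⟩
    · rcases List.mem_append.1 hs with h | h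
      exacts [hD s h, hD' s h]
    · rw [← comp_assoc, comp_mk D D']
  | zero => simp
  | add x y _ _ hx hy => simpa using Submodule.add_mem _ hx hy
  | smul c x _ hx => simpa using Submodule.smul_mem _ c hx

theorem comp_mem_capCupSpan {m n k : ℕ} {y : Skein n k}
    (hy : ∀ (j : ℕ) (E : Diagram j n), (∀ s ∈ E.1, s.kind = .cup) →
      comp (mk E) y ∈ capCupSpan j k) {x : Skein m n} (hx : x ∈ capCupSpan m n) :
    comp x y ∈ capCupSpan m k := by
  induction hx using Submodule.span_induction with
  | mem x hx =>
    obtain ⟨j, D, E, hD, hE, rfl⟩ := hx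
    rw [comp_assoc]
    exact comp_mem_capCupSpan_left (hy j E hE) D hD
  | zero => simp
  | add x y _ _ hx hy => simpa using Submodule.add_mem _ hx hy
  | smul c x _ hx => simpa using Submodule.smul_mem _ c hx

theorem eq_cup {s : Slice} (h : s.kind = .cup) : s = cup s.pos := by
  cases s; cases h; rfl

theorem eq_cap {s : Slice} (h : s.kind = .cap) : s = cap s.pos := by
  cases s; cases h; rfl

theorem isDiagram_cup {m n i : ℕ} : IsDiagram m [cup i] n ↔ i ≤ m ∧ n = m + 2 := by
  simp [IsDiagram, cup, Kind.ins, Kind.outs, eq_comm]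

theorem isDiagram_cap {m n i : ℕ} : IsDiagram m [cap i] n ↔ i + 2 ≤ m ∧ m = n + 2 := by
  simp only [IsDiagram, cap, Kind.ins, Kind.outs]
  omega

theorem W_cup (i : ℕ) : W [cup i] = U i := rfl

theorem W_cap (i : ℕ) : W [cap i] = C i := rfl

theorem mk_diag_append {m n k : ℕ} {u v : List Slice} (hu : IsDiagram m u n)
    (hv : IsDiagram n v k) (h : IsDiagram m (u ++ v) k) :
    mk (diag (u ++ v) h) = comp (mk (diag u hu)) (mk (diag v hv)) := by
  rw [comp_mk]
  rfl

theorem mk_cups_mem {m n : ℕ} {w : List Slice} (hw : IsDiagram m w n)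
    (hc : ∀ s ∈ w, s.kind = .cup) : mk (diag w hw) ∈ capCupSpan m n := by
  refine Submodule.subset_span ⟨m, Diagram.id m, diag w hw, by simp [Diagram.id], hc, ?_⟩
  rw [id_comp]

theorem mk_caps_mem {m n : ℕ} {w : List Slice} (hw : IsDiagram m w n)
    (hc : ∀ s ∈ w, s.kind = .cap) : mk (diag w hw) ∈ capCupSpan m n := by
  refine Submodule.subset_span ⟨n, diag w hw, Diagram.id n, hc, by simp [Diagram.id], ?_⟩
  rw [comp_id]

/-- A local maximum on top of local minima may be moved to the bottom or cancelled. -/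
theorem cups_comp_cap_mem {m n k : ℕ} {w : List Slice} (hw : IsDiagram m w n)
    (hc : ∀ s ∈ w, s.kind = .cup) {p : ℕ} (hp : IsDiagram n [cap p] k) :
    comp (mk (diag w hw)) (mk (diag [cap p] hp)) ∈ capCupSpan m k := by
  induction w using List.reverseRecOn generalizing n k p with
  | nil =>
    cases hw
    have := mk_caps_mem hp (by simp [cap])
    rwa [← id_comp (mk _)] at this
  | append_singleton w s ih =>
    obtain ⟨n', hw', hs⟩ := isDiagram_append.1 hw
    have hc' : ∀ s ∈ w, s.kind = .cup := fun s hs => hc s (by simp [hs])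
    rw [eq_cup (hc s (by simp))] at hs
    have hw2 : mk (diag (w ++ [s]) hw) = comp (mk (diag w hw')) (mk (diag [cup s.pos] hs)) := by
      rw [comp_mk]
      congr 1
      apply Subtype.ext
      change w ++ [s] = w ++ [cup s.pos]
      rw [← eq_cup (hc s (by simp))]
    rw [hw2, comp_assoc]
    have hs1 := isDiagram_cup.1 hs
    have hp1 := isDiagram_cap.1 hp
    obtain rfl : k = n' := by omega
    generalize s.pos = q at *
    have hmem := mk_cups_mem hw' hc'
    -- a maximum next to the last minimum cancels it; otherwise the two exchange their heights
    rcases lt_trichotomy p q with h | rfl | h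
    · obtain ⟨d, rfl⟩ := Nat.exists_eq_add_of_lt h
      rcases Nat.eq_zero_or_pos d with rfl | hd
      · have e : comp (mk (diag [cup (p + 0 + 1)] hs)) (mk (diag [cap p] hp)) =
            mk (Diagram.id k) := by
          apply ι_injective
          simp only [ι_comp, ι_id, ι_zero_mk, diag_val]
          exact U_succ_mul_C p
        rwa [e, comp_id]
      · have hp' : IsDiagram k [cap p] (k - 2) := isDiagram_cap.2 (by omega)
        have hs' : IsDiagram (k - 2) [cup (p + d - 1)] k := isDiagram_cup.2 (by omega)
        have e : comp (mk (diag [cup (p + d + 1)] hs)) (mk (diag [cap p] hp)) =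
            comp (mk (diag [cap p] hp')) (mk (diag [cup (p + d - 1)] hs')) := by
          apply ι_injective
          simp only [ι_comp, ι_zero_mk, diag_val]
          have := U_far_mul_C p (d - 1)
          rwa [show p + 2 + (d - 1) = p + d + 1 by omega,
            show p + (d - 1) = p + d - 1 by omega] at this
        rw [e, ← comp_assoc]
        exact comp_mem_capCupSpan_right (ih hw' hc' hp') _ (by simp [cup])
    · have e : comp (mk (diag [cup p] hs)) (mk (diag [cap p] hp)) = δ • mk (Diagram.id k) := by
        apply ι_injective
        simp only [ι_comp, ι_id, ι_zero_mk, diag_val, map_smul]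
        exact U_mul_C p
      rw [e, map_smul, comp_id]
      exact Submodule.smul_mem _ _ hmem
    · obtain ⟨d, rfl⟩ := Nat.exists_eq_add_of_lt h
      rcases Nat.eq_zero_or_pos d with rfl | hd
      · have e : comp (mk (diag [cup q] hs)) (mk (diag [cap (q + 0 + 1)] hp)) =
            mk (Diagram.id k) := by
          apply ι_injective
          simp only [ι_comp, ι_id, ι_zero_mk, diag_val]
          exact U_mul_C_succ q
        rwa [e, comp_id]
      · have hp' : IsDiagram k [cap (q + d - 1)] (k - 2) := isDiagram_cap.2 (by omega)
        have hs' : IsDiagram (k - 2) [cup q] k := isDiagram_cup.2 (by omega)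
        have e : comp (mk (diag [cup q] hs)) (mk (diag [cap (q + d + 1)] hp)) =
            comp (mk (diag [cap (q + d - 1)] hp')) (mk (diag [cup q] hs')) := by
          apply ι_injective
          simp only [ι_comp, ι_zero_mk, diag_val]
          have := U_mul_C_far q (d - 1)
          rwa [show q + 2 + (d - 1) = q + d + 1 by omega,
            show q + (d - 1) = q + d - 1 by omega] at this
        rw [e, ← comp_assoc]
        exact comp_mem_capCupSpan_right (ih hw' hc' hp') _ (by simp [cup])

theorem mk_mem_capCupSpan {m n : ℕ} {w : List Slice} (hw : IsDiagram m w n) :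
    mk (diag w hw) ∈ capCupSpan m n := by
  have hcap : ∀ {n k p : ℕ} (hp : IsDiagram n [cap p] k) {x : Skein m n}, x ∈ capCupSpan m n →
      comp x (mk (diag [cap p] hp)) ∈ capCupSpan m k := fun hp x hx =>
    comp_mem_capCupSpan (fun j E hE => cups_comp_cap_mem E.2 hE hp) hx
  -- a combination of a diagram with a hook and without it, as produced by smoothing a crossing
  have hhook : ∀ {n p : ℕ} (hp : p + 2 ≤ n) (a b : QA) {x z : Skein m n}, x ∈ capCupSpan m n →
      ι 0 z = ι 0 x * (a • 1 + b • (C p * U p)) → z ∈ capCupSpan m n := by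
    intro n p hp a b x z hx hz
    have h1 : IsDiagram n [cap p] (n - 2) := isDiagram_cap.2 (by omega)
    have h2 : IsDiagram (n - 2) [cup p] n := isDiagram_cup.2 (by omega)
    have e : z = a • x + b • comp (comp x (mk (diag [cap p] h1))) (mk (diag [cup p] h2)) := by
      apply ι_injective
      simp only [hz, map_add, map_smul, ι_comp, ι_zero_mk, diag_val, W_cup, W_cap, mul_add,
        mul_smul_comm, mul_one, mul_assoc]
    rw [e]
    exact Submodule.add_mem _ (Submodule.smul_mem _ _ hx) (Submodule.smul_mem _ _
      (comp_mem_capCupSpan_right (hcap h1 hx) _ (by simp [cup])))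
  induction w using List.reverseRecOn generalizing n with
  | nil => exact mk_cups_mem hw (by simp)
  | append_singleton w s ih =>
    obtain ⟨n', hw', hs⟩ := isDiagram_append.1 hw
    have hx := ih hw'
    have e : ι 0 (mk (diag (w ++ [s]) hw)) = ι 0 (mk (diag w hw')) * W [s] := by
      rw [ι_zero_mk, ι_zero_mk, diag_val, diag_val, W_append]
    obtain ⟨x, p⟩ := s
    have hs1 := hs.1
    have hs2 : n' - x.ins + x.outs = n := hs.2
    cases x with
    | cup =>
      rw [mk_diag_append hw' hs]
      exact comp_mem_capCupSpan_right hx _ (by simp)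
    | cap =>
      rw [mk_diag_append hw' hs]
      exact hcap hs hx
    | overX =>
      simp only [Kind.ins, Kind.outs] at hs1 hs2
      obtain rfl : n' = n := by omega
      exact hhook hs1 A A⁻¹ hx (e.trans (congrArg _ (W_overX p)))
    | underX =>
      simp only [Kind.ins, Kind.outs] at hs1 hs2
      obtain rfl : n' = n := by omega
      exact hhook hs1 A⁻¹ A hx (e.trans (congrArg _ (W_underX p)))

theorem capCupSpan_eq_top (m n : ℕ) : capCupSpan m n = ⊤ := by
  refine Submodule.eq_top_iff'.2 fun x => ?_
  induction x using skein_induction with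
  | h0 => exact Submodule.zero_mem _
  | hadd x y hx hy => exact Submodule.add_mem _ hx hy
  | hsmul c x hx => exact Submodule.smul_mem _ c hx
  | hmk D => exact mk_mem_capCupSpan D.2

/-- A linear property of skein elements need only be checked on diagrams that consist of local
maxima followed by local minima. -/
theorem capCup_induction {m n : ℕ} {M : Type*} [AddCommGroup M] [Module QA M]
    (f : Skein m n →ₗ[QA] M) (S : Submodule QA M)
    (h : ∀ (j : ℕ) (D : Diagram m j) (E : Diagram j n), (∀ s ∈ D.1, s.kind = .cap) →
      (∀ s ∈ E.1, s.kind = .cup) → f (comp (mk D) (mk E)) ∈ S) (x : Skein m n) : f x ∈ S := by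
  have h1 : capCupSpan m n ≤ S.comap f := by
    refine Submodule.span_le.2 ?_
    rintro _ ⟨j, D, E, hD, hE, rfl⟩
    exact h j D E hD hE
  exact h1 (capCupSpan_eq_top m n ▸ Submodule.mem_top)

theorem IsDiagram.caps_length {w : List Slice} {n : ℕ} : ∀ {m : ℕ}, IsDiagram m w n →
    (∀ s ∈ w, s.kind = .cap) → m = n + 2 * w.length := by
  induction w with
  | nil => intro m h _; exact h
  | cons s w ih =>
    intro m h hc
    have h1 := h.1
    have h2 := ih h.2 fun s hs => hc s (by simp [hs])
    rw [hc s (by simp)] at h1 h2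
    simp only [Kind.ins, Kind.outs, List.length_cons] at h1 h2 ⊢
    omega

theorem IsDiagram.cups_length {w : List Slice} {n : ℕ} : ∀ {m : ℕ}, IsDiagram m w n →
    (∀ s ∈ w, s.kind = .cup) → n = m + 2 * w.length := by
  induction w with
  | nil => intro m h _; exact h.symm
  | cons s w ih =>
    intro m h hc
    have h2 := ih h.2 fun s hs => hc s (by simp [hs])
    rw [hc s (by simp)] at h2
    simp only [Kind.ins, Kind.outs, List.length_cons] at h2 ⊢
    omega


/-! ### The skein module of the annulus -/

theorem STC_mk {k : ℕ} (D : Diagram k k) : STC k (mk D) = mkClosure D := lift_mk _ _ _ _ _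

/-- The closure is invariant under rotation of the annulus. -/
theorem STC_comp_comm {m n : ℕ} (x : Skein m n) (y : Skein n m) :
    STC m (comp x y) = STC n (comp y x) := by
  induction x using skein_induction with
  | h0 => simp
  | hadd x x' hx hx' => simp only [map_add, LinearMap.add_apply, hx, hx']
  | hsmul c x hx => simp only [map_smul, LinearMap.smul_apply, hx]
  | hmk D =>
    induction y using skein_induction with
    | h0 => simp
    | hadd y y' hy hy' => simp only [map_add, LinearMap.add_apply, hy, hy']
    | hsmul c y hy => simp only [map_smul, LinearMap.smul_apply, hy]
    | hmk E =>
      rw [comp_mk, comp_mk, STC_mk, STC_mk, mkClosure, mkClosure, link, link,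
        Quot.sound (AnnularStep.rotate D E)]

/-- The value of a polynomial at the core of the annulus. -/
def evalCore : Polynomial QA →ₗ[QA] AnnularSkein :=
  Polynomial.lsum fun k => LinearMap.toSpanSingleton QA AnnularSkein (zPow k)

theorem chebyshev_eq (j : ℕ) : chebyshev j = evalCore (Polynomial.Chebyshev.S QA j) := rfl

theorem evalCore_monomial (k : ℕ) (c : QA) : evalCore (Polynomial.monomial k c) = c • zPow k :=
  Polynomial.sum_monomial_index c _ (zero_smul _ _)

theorem traceFunctional_evalCore (t : QA) (ht : t ≠ 0) (p : Polynomial QA) :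
    traceFunctional t ht (evalCore p) = p.eval (t + t⁻¹) := by
  induction p using Polynomial.induction_on' with
  | add p q hp hq => rw [map_add, map_add, hp, hq, Polynomial.eval_add]
  | monomial k c =>
    rw [evalCore_monomial, map_smul, traceFunctional_zPow, Polynomial.eval_monomial, smul_eq_mul]

/-- The powers of the core are linearly independent: a polynomial in the core that vanishes has
infinitely many roots `t + t⁻¹`. -/
theorem evalCore_injective : Function.Injective evalCore := by
  refine (injective_iff_map_eq_zero evalCore).2 fun p hp => ?_
  have hne : ∀ n : ℕ, ((n + 1 : ℕ) : QA) ≠ 0 := fun n => Nat.cast_ne_zero.2 n.succ_ne_zero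
  refine Polynomial.eq_zero_of_infinite_isRoot p (Set.Infinite.mono ?_
    (Set.infinite_range_of_injective
      (f := fun n : ℕ => ((n + 1 : ℕ) : QA) + ((n + 1 : ℕ) : QA)⁻¹) ?_))
  · rintro _ ⟨n, rfl⟩
    change p.eval _ = 0
    rw [← traceFunctional_evalCore _ (hne n), hp, map_zero]
  · intro m n h
    have hm := hne m
    have hn := hne n
    have h' : (((m + 1 : ℕ) : QA) - ((n + 1 : ℕ) : QA)) *
        (((m + 1 : ℕ) : QA) * ((n + 1 : ℕ) : QA) - 1) = 0 := by
      dsimp only at h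
      generalize ((m + 1 : ℕ) : QA) = a at *
      generalize ((n + 1 : ℕ) : QA) = b at *
      field_simp at h
      linear_combination h
    rcases mul_eq_zero.1 h' with h1 | h1
    · have := Nat.cast_injective (sub_eq_zero.1 h1)
      omega
    · have h2 : ((m + 1) * (n + 1) : ℕ) = 1 := by
        have h3 := sub_eq_zero.1 h1
        rw [← Nat.cast_mul] at h3
        exact_mod_cast h3
      have h4 := Nat.eq_one_of_mul_eq_one_right h2
      have h5 := Nat.eq_one_of_mul_eq_one_left h2
      omega

/-- Closures of diagrams are combinations of powers of the core: a diagram that consists of local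
maxima followed by local minima can be rotated to a diagram on fewer strands. -/
theorem STC_mem_range (k : ℕ) (x : TL k) : STC k x ∈ LinearMap.range evalCore := by
  induction k using Nat.strong_induction_on with
  | _ k ih =>
    refine capCup_induction (STC k) _ (fun j D E hD hE => ?_) x
    have h1 := D.2.caps_length hD
    have h2 := E.2.cups_length hE
    rcases Nat.eq_zero_or_pos D.1.length with h | h
    · have hD0 := List.length_eq_zero_iff.1 h
      have hE0 : E.1 = [] := List.length_eq_zero_iff.1 (by omega)
      refine ⟨Polynomial.monomial k 1, ?_⟩
      rw [evalCore_monomial, one_smul, comp_mk, STC_mk, zPow]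
      congr 1
      apply Subtype.ext
      simp [Diagram.comp, Diagram.id, hD0, hE0]
    · rw [STC_comp_comm]
      exact ih j (by omega) _

theorem evalCore_surjective : Function.Surjective evalCore := by
  intro x
  obtain ⟨f, rfl⟩ := Submodule.mkQ_surjective _ x
  induction f using Finsupp.induction_linear with
  | zero => exact ⟨0, by simp⟩
  | add f g hf hg =>
    obtain ⟨p, hp⟩ := hf
    obtain ⟨q, hq⟩ := hg
    exact ⟨p + q, by rw [map_add, map_add, hp, hq]⟩
  | single D c =>
    induction D using Quot.ind with
    | mk D =>
      obtain ⟨p, hp⟩ := STC_mem_range D.1 (mk D.2)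
      refine ⟨c • p, ?_⟩
      rw [map_smul, hp, STC_mk, mkClosure, ← map_smul, link, Finsupp.smul_single, smul_eq_mul,
        mul_one]

theorem degree_chebyshev_S (n : ℕ) : (Polynomial.Chebyshev.S QA n).degree = n := by
  induction n using Nat.twoStepInduction with
  | zero => simp
  | one => simp
  | more n h0 h1 =>
    push_cast at h1 ⊢
    have h2 : (Polynomial.X * Polynomial.Chebyshev.S QA (n + 1)).degree =
        ((n + 2 : ℕ) : WithBot ℕ) := by
      rw [Polynomial.degree_mul, h1, Polynomial.degree_X]
      push_cast
      ring
    rw [Polynomial.Chebyshev.S_add_two, Polynomial.degree_sub_eq_left_of_degree_lt, h2]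
    · push_cast
      rfl
    · rw [h0, h2]
      exact_mod_cast (by omega : n < n + 2)

/-- The Chebyshev elements form a basis of the skein module of the annulus. -/
def chebyshevBasis : Module.Basis ℕ QA AnnularSkein :=
  (Polynomial.Sequence.basis ⟨fun n => Polynomial.Chebyshev.S QA n, degree_chebyshev_S⟩
    fun _ => IsUnit.mk0 _ (Polynomial.leadingCoeff_ne_zero.2 (Polynomial.Sequence.ne_zero _ _))).map
    (LinearEquiv.ofBijective evalCore ⟨evalCore_injective, evalCore_surjective⟩)

theorem chebyshevBasis_apply (j : ℕ) : chebyshevBasis j = chebyshev j := by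
  simp only [chebyshevBasis, Module.Basis.map_apply, Polynomial.Sequence.basis_eq_self]
  rfl

/-! ### Closures of Jones-Wenzl projectors -/

/-- Adding a parallel copy of the core on one side of a link in the solid torus. -/
def addCore : AnnularSkein →ₗ[QA] AnnularSkein :=
  annularRelations.liftQ
    (Finsupp.linearCombination QA (Quot.lift
      (fun D : AnnularDiagram => mkClosure (D.2.tensor (Diagram.id 1)))
      (by
        rintro _ _ (h | ⟨D, E⟩)
        · exact mkClosure_step (h.tensor_right _)
        · have e : ∀ {m n : ℕ} (D : Diagram m n) (E : Diagram n m),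
              mkClosure ((D.comp E).tensor (Diagram.id 1)) =
                STC (m + 1) (comp (mk (D.tensor (Diagram.id 1)))
                  (mk (E.tensor (Diagram.id 1)))) := by
            intro m n D E
            rw [comp_mk, STC_mk]
            congr 1
            apply Subtype.ext
            simp [Diagram.comp, Diagram.tensor, Diagram.id]
          exact (e D E).trans ((STC_comp_comm _ _).trans (e E D).symm))))
    (by
      refine Submodule.span_le.2 ?_
      rintro x (⟨k, D, D₀, D₁, h, rfl⟩ | ⟨k, D, D₀, h, rfl⟩)
      · have := mkClosure_triple (h.tensor_right (Diagram.id 1))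
        simp only [SetLike.mem_coe, LinearMap.mem_ker, map_sub, map_smul, link,
          Finsupp.linearCombination_single, one_smul, this]
        abel
      · have := mkClosure_circle (h.tensor_right (Diagram.id 1))
        simp only [SetLike.mem_coe, LinearMap.mem_ker, map_add, map_smul, link,
          Finsupp.linearCombination_single, one_smul, this, ← add_smul, δ]
        convert zero_smul QA _ using 2
        ring)

theorem addCore_mkClosure {k : ℕ} (D : Diagram k k) :
    addCore (mkClosure D) = mkClosure (D.tensor (Diagram.id 1)) := by
  refine (Submodule.liftQ_apply _ _ _).trans ?_
  simp [link]

theorem addCore_STC (k : ℕ) (x : TL k) :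
    addCore (STC k x) = STC (k + 1) (tensor x (mk (Diagram.id 1))) := by
  induction x using skein_induction with
  | h0 => simp
  | hadd x y hx hy => simp only [map_add, LinearMap.add_apply, hx, hy]
  | hsmul c x hx => simp only [map_smul, LinearMap.smul_apply, hx]
  | hmk D => rw [STC_mk, addCore_mkClosure, tensor_mk, STC_mk]

theorem addCore_evalCore (p : Polynomial QA) :
    addCore (evalCore p) = evalCore (Polynomial.X * p) := by
  induction p using Polynomial.induction_on' with
  | add p q hp hq => rw [map_add, map_add, hp, hq, mul_add, map_add]
  | monomial k c =>
    rw [Polynomial.X_mul_monomial, evalCore_monomial, evalCore_monomial, map_smul, zPow,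
      addCore_mkClosure, zPow]
    congr 2

/-- The closure of a Jones-Wenzl projector is a Chebyshev element. -/
theorem STC_jonesWenzl (m : ℕ) : STC m (jonesWenzl m) = chebyshev m := by
  rw [chebyshev_eq]
  induction m using Nat.twoStepInduction with
  | zero =>
    rw [jonesWenzl, STC_mk, Nat.cast_zero, Polynomial.Chebyshev.S_zero,
      ← Polynomial.monomial_zero_one, evalCore_monomial, one_smul, zPow]
  | one =>
    rw [jonesWenzl, STC_mk, Nat.cast_one, Polynomial.Chebyshev.S_one, Polynomial.X,
      evalCore_monomial, one_smul, zPow]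
  | more n h0 h1 =>
    have hc : IsDiagram (n + 2) [cap n] n := isDiagram_cap.2 ⟨le_rfl, rfl⟩
    have hu : IsDiagram n [cup n] (n + 2) := isDiagram_cup.2 ⟨le_rfl, rfl⟩
    have e : mk (hook n) = comp (mk (diag _ hc)) (mk (diag _ hu)) := by
      rw [comp_mk]
      rfl
    set g : TL (n + 2) := tensor (jonesWenzl (n + 1)) (mk (Diagram.id 1)) with hg
    have hιg : ι 0 g = jw 0 (n + 1) := (ι_tensor 0 _ _).trans (by rw [ι_id, mul_one, jw])
    -- rotating the annulus turns the second term of the recursion into a partial closure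
    have h2 : STC (n + 2) (comp (comp g (mk (hook n))) g) =
        (Δ (n + 1) / Δ n) • STC n (jonesWenzl n) := by
      rw [e, ← comp_assoc, comp_assoc, STC_comp_comm, ← map_smul]
      congr 1
      apply ι_injective
      have hp := partial_closure 0 n
      simp only [zero_add] at hp
      rw [map_smul, ι_comp, ι_comp, ι_comp, hιg, ι_zero_mk, ι_zero_mk, diag_val, diag_val, W_cup,
        W_cap, mul_assoc, mul_mul_of_mul_eq (jw_mul_jw 0 (n + 1)), ← mul_assoc, hp, jw]
    have h3 : STC (n + 2) g = evalCore (Polynomial.X * Polynomial.Chebyshev.S QA (n + 1 : ℕ)) := by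
      rw [← addCore_evalCore, ← h1]
      exact (addCore_STC (n + 1) _).symm
    have h4 : jonesWenzl (n + 2) =
        g - ratio (n + 1) • comp (comp g (mk (hook n))) g := rfl
    rw [h4, map_sub, map_smul, h2, h3, smul_smul, ratio_mul, one_smul, h0, ← map_sub]
    congr 1
    push_cast
    rw [Polynomial.Chebyshev.S_add_two]


/-! ### The colored Temperley-Lieb module -/

theorem ι_twoBoxes (n : ℕ) : ι 0 (twoBoxes n) = boxes n := by
  have := ι_tensor 0 (jonesWenzl n) (jonesWenzl n)
  rwa [zero_add] at this

theorem ι_caps {i n : ℕ} (h : i ≤ n) : ι 0 (mk (caps i n h)) = nestedCaps i (n - i) := ι_zero_mk _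

theorem ι_cups {i n : ℕ} (h : i ≤ n) : ι 0 (mk (cups i n h)) = nestedCups i (n - i) := ι_zero_mk _

theorem boxes_mul_C_eq_zero {n p : ℕ} (hp : p + 2 ≤ n + n) (h : p + 1 ≠ n) :
    boxes n * C p = 0 := by
  rcases Nat.lt_or_gt_of_ne h with h | h
  · have := jw_mul_C (k := 0) h
    rw [zero_add] at this
    rw [boxes, boxes_comm, mul_assoc, this, mul_zero]
  · obtain ⟨q, rfl⟩ := Nat.exists_eq_add_of_le (Nat.le_of_lt_succ h)
    rw [boxes, mul_assoc, jw_mul_C (by omega), mul_zero]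

theorem U_mul_boxes_eq_zero {n p : ℕ} (hp : p + 2 ≤ n + n) (h : p + 1 ≠ n) :
    U p * boxes n = 0 := by
  rcases Nat.lt_or_gt_of_ne h with h | h
  · have := U_mul_jw_eq_zero (k := 0) h
    rw [zero_add] at this
    rw [boxes, ← mul_assoc, this, zero_mul]
  · obtain ⟨q, rfl⟩ := Nat.exists_eq_add_of_le (Nat.le_of_lt_succ h)
    rw [boxes, boxes_comm, ← mul_assoc, U_mul_jw_eq_zero (by omega), zero_mul]

/-- Two projectors side by side kill all systems of local maxima but the nested ones between
them. -/
theorem boxes_mul_caps {w : List Slice} {j : ℕ} (hc : ∀ s ∈ w, s.kind = .cap) :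
    ∀ {n : ℕ}, IsDiagram (n + n) w j → boxes n * W w = 0 ∨
      ∃ i ≤ n, j = i + i ∧ boxes n * W w = boxes n * nestedCaps i (n - i) := by
  induction w with
  | nil =>
    intro n h
    refine Or.inr ⟨n, le_rfl, Eq.symm h, ?_⟩
    rw [Nat.sub_self]
    rfl
  | cons s w ih =>
    intro n h
    have hs := eq_cap (hc s (by simp))
    rw [hs] at h ⊢
    generalize s.pos = p at h
    rw [W_cons, ← mul_assoc, W_cap]
    have hp : p + 2 ≤ n + n := h.1
    by_cases hn : p + 1 = n
    · subst hn
      have h2 : IsDiagram (p + p) w j := by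
        have h3 := h.2
        rwa [show p + 1 + (p + 1) - (cap p).kind.ins + (cap p).kind.outs = p + p by
          simp only [cap, Kind.ins, Kind.outs]; omega] at h3
      have e : boxes (p + 1) * C p = boxes (p + 1) * C p * boxes p := by
        rw [mul_assoc, ← C_mul_boxes, ← mul_assoc, boxes_absorb]
      rcases ih (fun s hs => hc s (by simp [hs])) h2 with h4 | ⟨i, hi, hj, h4⟩
      · exact Or.inl (by rw [e, mul_assoc, h4, mul_zero])
      · refine Or.inr ⟨i, by omega, hj, ?_⟩
        rw [e, mul_assoc, h4, ← mul_assoc, ← e, Nat.succ_sub hi, nestedCaps_succ, mul_assoc,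
          Nat.add_sub_cancel' hi]
    · exact Or.inl (by rw [boxes_mul_C_eq_zero hp hn, zero_mul])

/-- The mirror image of `boxes_mul_caps`. -/
theorem cups_mul_boxes {w : List Slice} {j : ℕ} (hc : ∀ s ∈ w, s.kind = .cup) :
    ∀ {n : ℕ}, IsDiagram j w (n + n) → W w * boxes n = 0 ∨
      ∃ i ≤ n, j = i + i ∧ W w * boxes n = nestedCups i (n - i) * boxes n := by
  induction w using List.reverseRecOn with
  | nil =>
    intro n h
    refine Or.inr ⟨n, le_rfl, h, ?_⟩
    rw [Nat.sub_self]
    rfl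
  | append_singleton w s ih =>
    intro n h
    obtain ⟨m, hw, hs'⟩ := isDiagram_append.1 h
    have hs := eq_cup (hc s (by simp))
    rw [hs] at hs' ⊢
    generalize s.pos = p at hs'
    rw [W_append, mul_assoc, W_cup]
    have hp := isDiagram_cup.1 hs'
    by_cases hn : p + 1 = n
    · subst hn
      obtain rfl : m = p + p := by omega
      have e : U p * boxes (p + 1) = boxes p * (U p * boxes (p + 1)) := by
        rw [← mul_assoc, ← U_mul_boxes, mul_assoc, boxes_absorb']
      rcases ih (fun s hs => hc s (by simp [hs])) hw with h4 | ⟨i, hi, hj, h4⟩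
      · exact Or.inl (by rw [e, ← mul_assoc, h4, zero_mul])
      · refine Or.inr ⟨i, by omega, hj, ?_⟩
        rw [e, ← mul_assoc, h4, mul_assoc, ← e, Nat.succ_sub hi, nestedCups_succ, mul_assoc,
          Nat.add_sub_cancel' hi]
    · exact Or.inl (by rw [U_mul_boxes_eq_zero (by omega) hn, mul_zero])

/-- The diagram with `2i` vertical strands between two pairs of projectors, the other strands
turning back. -/
def turnback (n i : ℕ) (h : i ≤ n) : TL (n + n) :=
  comp (twoBoxes n) (comp (mk (caps i n h)) (comp (mk (cups i n h)) (twoBoxes n)))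

theorem mem_coloredTL {n : ℕ} {x : TL (n + n)} :
    x ∈ coloredTL n ↔ ∃ y, comp (twoBoxes n) (comp y (twoBoxes n)) = x := Iff.rfl

theorem coloredTL_le_span (n : ℕ) : coloredTL n ≤
    Submodule.span QA
      (Set.range fun i : Fin (n + 1) => turnback n i (Nat.lt_succ_iff.1 i.isLt)) := by
  intro x hx
  obtain ⟨y, rfl⟩ := mem_coloredTL.1 hx
  refine capCup_induction ((comp (twoBoxes n)).comp (comp.flip (twoBoxes n))) _
    (fun j D E hD hE => ?_) y
  change comp (twoBoxes n) (comp (comp (mk D) (mk E)) (twoBoxes n)) ∈ _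
  have e : ι 0 (comp (twoBoxes n) (comp (comp (mk D) (mk E)) (twoBoxes n))) =
      boxes n * W D.1 * (W E.1 * boxes n) := by
    simp only [ι_comp, ι_twoBoxes, ι_zero_mk, mul_assoc]
  have hz : boxes n * W D.1 * (W E.1 * boxes n) = 0 →
      comp (twoBoxes n) (comp (comp (mk D) (mk E)) (twoBoxes n)) ∈ Submodule.span QA
        (Set.range fun i : Fin (n + 1) => turnback n i (Nat.lt_succ_iff.1 i.isLt)) := by
    intro h
    rw [← e, ← map_zero (ι 0)] at h
    rw [ι_injective h]
    exact Submodule.zero_mem _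
  rcases boxes_mul_caps hD D.2 with h1 | ⟨i, hi, hj, h1⟩
  · exact hz (by rw [h1, zero_mul])
  rcases cups_mul_boxes hE E.2 with h2 | ⟨i', hi', hj', h2⟩
  · exact hz (by rw [h2, mul_zero])
  obtain rfl : i = i' := by omega
  refine Submodule.subset_span ⟨⟨i, Nat.lt_succ_iff.2 hi⟩, ?_⟩
  apply ι_injective
  rw [e, h1, h2]
  simp only [turnback, ι_comp, ι_twoBoxes, ι_caps, ι_cups, mul_assoc]

theorem B_mem_coloredTL (n i : ℕ) (h : i ≤ n) : B n i h ∈ coloredTL n := by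
  refine mem_coloredTL.2 ⟨comp (mk (caps i n h)) (comp (jonesWenzl (i + i)) (mk (cups i n h))), ?_⟩
  simp only [B, comp_assoc]

/-! ### Theta graphs and closures of the basis -/

/-- The factor by which a theta graph of type `(n, n, 2i)` exceeds a circle colored `2i`. -/
def thetaFactor (n i : ℕ) : QA := ∏ l ∈ Finset.range (n - i), arcFactor i (l + 1)

theorem thetaFactor_ne_zero (n i : ℕ) : thetaFactor n i ≠ 0 :=
  Finset.prod_ne_zero_iff.2 fun _ _ => arcFactor_ne_zero _ _

/-- A vertex closed with its mirror image along the edges colored `n` is a multiple of the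
projector. -/
theorem vertex_comp_vertex (n i : ℕ) (h : i ≤ n) :
    jw 0 (i + i) * (nestedCups i (n - i) * (boxes n * nestedCaps i (n - i))) =
      thetaFactor n i • jw 0 (i + i) := by
  have := vertex_mul_nestedCaps i (n - i)
  rw [vertex, Nat.add_sub_cancel' h, mul_assoc, mul_assoc] at this
  exact this

theorem mk_id_zero_ne_zero : mk (Diagram.id 0) ≠ 0 := by
  intro h
  have h1 := congrArg (STC 0) h
  rw [map_zero, STC_mk] at h1
  have h2 : evalCore (Polynomial.monomial 0 1) = 0 := by
    rw [evalCore_monomial, one_smul]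
    exact h1
  have h3 := evalCore_injective (h2.trans (map_zero evalCore).symm)
  rw [Polynomial.monomial_eq_zero_iff] at h3
  exact one_ne_zero h3

theorem bracket_smul (c : QA) : bracket (c • mk (Diagram.id 0)) = c := by
  have h := Classical.epsilon_spec
    (p := fun d : QA => c • mk (Diagram.id 0) = d • mk (Diagram.id 0)) ⟨c, rfl⟩
  exact (smul_left_injective QA mk_id_zero_ne_zero h).symm

theorem θ_eq (n i : ℕ) (h : i ≤ n) : θ n i h = thetaFactor n i * Δ (2 * i) := by
  have e : comp (jonesWenzl (i + i)) (comp (mk (cups i n h)) (comp (twoBoxes n)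
      (mk (caps i n h)))) = thetaFactor n i • jonesWenzl (i + i) := by
    apply ι_injective
    simp only [ι_comp, ι_cups, ι_caps, ι_twoBoxes, map_smul]
    exact vertex_comp_vertex n i h
  have e2 : ∀ m : ℕ, planeClosure (jonesWenzl m) = Δ m • mk (Diagram.id 0) := by
    intro m
    apply ι_injective
    have h1 : ι 0 (tensor (jonesWenzl m) (mk (Diagram.id m))) = jw 0 m :=
      (ι_tensor 0 _ _).trans (by rw [ι_id, mul_one, jw])
    have h2 := nestedCups_mul_jw_mul_nestedCaps m
    have h3 : ι 0 (planeClosure (jonesWenzl m)) = nestedCups 0 m * jw 0 m * nestedCaps 0 m :=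
      (ι_comp 0 _ _).trans (congrArg₂ (· * ·) ((ι_comp 0 _ _).trans
        (congrArg₂ (· * ·) (ι_cups m.zero_le) h1)) (ι_caps m.zero_le))
    rw [h3, h2, map_smul, ι_id]
  have e3 : planeClosure (thetaFactor n i • jonesWenzl (i + i)) =
      thetaFactor n i • planeClosure (jonesWenzl (i + i)) := by
    simp only [planeClosure, map_smul, LinearMap.smul_apply]
  rw [θ, e, e3, e2, smul_smul, bracket_smul, two_mul]

theorem STC_B (n i : ℕ) (h : i ≤ n) :
    STC (n + n) (B n i h) = thetaFactor n i • chebyshev (2 * i) := by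
  have e : comp (comp (jonesWenzl (i + i)) (comp (mk (cups i n h)) (twoBoxes n)))
      (comp (twoBoxes n) (mk (caps i n h))) = thetaFactor n i • jonesWenzl (i + i) := by
    apply ι_injective
    simp only [ι_comp, ι_cups, ι_caps, ι_twoBoxes, map_smul, mul_assoc]
    rw [mul_mul_of_mul_eq (boxes_mul_boxes n)]
    exact vertex_comp_vertex n i h
  rw [B, ← comp_assoc, STC_comp_comm, e, map_smul, STC_jonesWenzl, two_mul]

/-- The element `B_{n,i}` of the colored Temperley-Lieb module. -/
def coloredB (n : ℕ) (i : Fin (n + 1)) : coloredTL n :=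
  ⟨B n i (Nat.lt_succ_iff.1 i.isLt), B_mem_coloredTL _ _ _⟩

theorem STC'_coloredB (n : ℕ) (i : Fin (n + 1)) :
    STC' n (coloredB n i) = thetaFactor n i • chebyshev (2 * i) := STC_B n i _

theorem linearIndependent_STC'_coloredB (n : ℕ) :
    LinearIndependent QA fun i => STC' n (coloredB n i) := by
  have h := chebyshevBasis.linearIndependent.comp (fun i : Fin (n + 1) => 2 * (i : ℕ))
    fun i j hij => Fin.ext (by simpa using hij)
  have := h.units_smul fun i => Units.mk0 (thetaFactor n i) (thetaFactor_ne_zero n i)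
  convert this using 1
  funext i
  rw [STC'_coloredB, ← chebyshevBasis_apply]
  rfl

/-- The elements `B_{n,i}` form a basis: their closures are independent, and the module is spanned
by `n + 1` elements. -/
theorem exists_basis_coloredTL (n : ℕ) :
    ∃ b : Module.Basis (Fin (n + 1)) QA (coloredTL n), ∀ i, b i = coloredB n i := by
  have hli : LinearIndependent QA (coloredB n) := (linearIndependent_STC'_coloredB n).of_comp
  have hfin := FiniteDimensional.span_of_finite QA (Set.finite_range
    fun i : Fin (n + 1) => turnback n i (Nat.lt_succ_iff.1 i.isLt))
  have : FiniteDimensional QA (coloredTL n) :=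
    Submodule.finiteDimensional_of_le (coloredTL_le_span n)
  have h1 : Module.finrank QA (coloredTL n) ≤ Fintype.card (Fin (n + 1)) :=
    (Submodule.finrank_mono (coloredTL_le_span n)).trans (finrank_range_le_card _)
  have h2 := hli.fintype_card_le_finrank
  exact ⟨basisOfLinearIndependentOfCardEqFinrank hli (le_antisymm h2 h1), fun i => by simp⟩

end
end KauffmanSkein

theorem mainTheorem4 (n : ℕ) :
    Function.Bijective (KauffmanSkein.STC' n).rangeRestrict ∧
    (∃ b : Module.Basis (Fin (n + 1)) KauffmanSkein.QA (KauffmanSkein.coloredTL n),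
      ∀ i : Fin (n + 1),
        (b i : KauffmanSkein.TL (n + n)) = KauffmanSkein.B n i (Nat.lt_succ_iff.mp i.isLt) ∧
        KauffmanSkein.STC' n (b i) =
          (KauffmanSkein.θ n i (Nat.lt_succ_iff.mp i.isLt) / KauffmanSkein.Δ (2 * (i : ℕ))) •
            KauffmanSkein.chebyshev (2 * (i : ℕ))) ∧
    (∃ b : Module.Basis ℕ KauffmanSkein.QA KauffmanSkein.AnnularSkein,
      ∀ j : ℕ, b j = KauffmanSkein.chebyshev j) := by
  obtain ⟨b, hb⟩ := KauffmanSkein.exists_basis_coloredTL n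
  refine ⟨⟨?_, LinearMap.surjective_rangeRestrict _⟩, ⟨b, fun i => ⟨?_, ?_⟩⟩,
    KauffmanSkein.chebyshevBasis, KauffmanSkein.chebyshevBasis_apply⟩
  · have hli := KauffmanSkein.linearIndependent_STC'_coloredB n
    rw [← LinearMap.ker_eq_bot, LinearMap.ker_rangeRestrict, LinearMap.ker_eq_bot']
    intro x hx
    rw [← b.sum_repr x, map_sum] at hx
    simp only [map_smul, hb] at hx
    have h0 := Fintype.linearIndependent_iff.1 hli _ hx
    rw [← b.sum_repr x]
    simp [h0]
  · rw [hb, KauffmanSkein.coloredB]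
  · rw [hb, KauffmanSkein.STC'_coloredB, KauffmanSkein.θ_eq,
      mul_div_cancel_right₀ _ (KauffmanSkein.Δ_ne_zero _)]
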